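/- **Setting (MST-U).** An uncertainty graph is a finite connected simple graph $G=(V,E)$ with query costs $q_e>0$ and nonempty uncertainty sets $A_e\subset\mathbb R$, each of which is either a singleton or contains neither its infimum $L_e$ nor its supremum $U_e$ (the limits are extended reals; the sets may be unbounded). Hidden weights $w_e\in A_e$ are revealed by queries; querying $e$ costs $q_e$ and replaces $A_e$ by $\{w_e\}$. A set $Q\subseteq E$ is feasible if some spanning tree $T$ is a minimum spanning tree for every weight function $\bar w$ with $\bar w_e=w_e$ for $e\in Q$ and $\bar w_e\in A_e$ for $e\notin Q$. $\mathrm{OPT}$ is the minimum cost of a feasible query set. A randomized algorithm is a random adaptive query strategy that almost surely queries a feasible set, whatever the weights; it is $c$-competitive if its expected query cost is at most $c\cdot\mathrm{OPT}$ for all weights. A cactus is a connected graph in which any two different cycles share at most one vertex. A lower (upper) limit tree is a minimum spanning tree for the weights $L_e$ (resp. $U_e$), where infinite limits are replaced by $\pm M$ with $M$ large. An edge $g$ of a cycle $C$ is always maximal in $C$ if $L_g\ge U_e$ for all $e\in C-g$. **The algorithm $\mathrm{Random}_C$.** Draw $b$ uniformly from $[0,1]$. Preprocessing: while the lower limit tree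 $T_L$ and the upper limit tree $T_U$ (chosen such that $|T_L\setminus T_U|$ is as small as possible) differ, query the edges of $T_L\setminus T_U$. Then fix $T_L=T_U$, and treat the edges $f\notin T_L$ one after the other, in any order: let $C$ be the cycle in $T_L+f$, $X(f)=\{e\in C-f: U_e>L_f\}$, and $q_{X(f)}=\sum_{e\in X(f)}q_e$. If $X(f)\neq\emptyset$, query all edges of $X(f)$ if $b\le p:=\frac{q_f^2}{q_f^2+q_{X(f)}^2}$, and query $f$ otherwise; then, as long as no edge of $C$ is always maximal, query an unqueried edge of $C$ with largest upper limit. The remaining choices (ties, orders) are made by an arbitrary rule that depends only on the revealed information, not on $b$. **Theorem 1.** (i) On every cactus, $\mathrm{Random}_C$ is well defined (choices as described exist), its preprocessing ends with $T_L=T_U$, it always queries a feasible set, and for all weights its expected query cost is at most $\frac32\,\mathrm{OPT}$. (ii) This is best possible: there is a triangle with uncertainty sets and unit query costs such that for every randomized algorithm there are weights with $\mathrm{OPT}>0$ for which its expected query cost is at least $\frac32\,\mathrm{OPT}$. (iii) If $G$ is a cycle and $f$ is the only edge outside $T_L=T_U$ after the preprocessing, then, for all weights, the expected query cost of $\mathrm{Random}_C$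 is at most $$\Bigl(1+\frac{q_{X(f)}\,q_f}{q_{X(f)}^2+q_f^2}\Bigr)\mathrm{OPT}.$$ This ratio is attained: for all $a,c>0$ there are a cycle, uncertainty sets, query costs and weights with $q_f=a$, $q_{X(f)}=c$ and $\mathrm{OPT}>0$ for which equality holds. -/

import Mathlib

open scoped Classical
open MeasureTheory Filter

universe u v

namespace MSTU

/-! ### Adaptive query programs -/

/-- A deterministic adaptive query program on a set `E` of items: it either stops and returns a
value, or queries an item and continues depending on the number that is revealed.  The revealed
answers are the only access that such a program has to the hidden weights. -/
inductive Program (E : Type u) (α : Type v) : Type (max u v)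
  | done (a : α) : Program E α
  | query (e : E) (next : ℝ → Program E α) : Program E α

namespace Program

variable {E : Type u} {α β : Type v}

/-- Sequential composition. -/
def bind : Program E α → (α → Program E β) → Program E β
  | done a, g => g a
  | query e next, g => query e (fun x => (next x).bind g)

/-- The value returned when the hidden weights are `w`. -/
def result (w : E → ℝ) : Program E α → α
  | done a => a
  | query e next => (next (w e)).result w

/-- The set of items queried when the hidden weights are `w`. -/
noncomputable def queries (w : E → ℝ) : Program E α → Finset E
  | done _ => ∅
  | query e next => insert e ((next (w e)).queries w)

end Program

/-! ### Limits of uncertainty sets -/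

section Limits

variable {E : Type u}

/-- The lower limit `L_e` of an uncertainty set. It is an extended real, since the set may be
unbounded. -/
noncomputable def lower (A : E → Set ℝ) (e : E) : EReal := sInf ((fun x : ℝ => (x : EReal)) '' A e)

/-- The upper limit `U_e` of an uncertainty set. -/
noncomputable def upper (A : E → Set ℝ) (e : E) : EReal := sSup ((fun x : ℝ => (x : EReal)) '' A e)

/-- The edge `f` is always maximal in (the cycle with edge set) `C`. -/
def AlwaysMaximal (A : E → Set ℝ) (C : Set E) (f : E) : Prop :=
  f ∈ C ∧ ∀ e ∈ C, e ≠ f → upper A e ≤ lower A f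

/-- The neighbors `X(f)` of `f` in (the cycle with edge set) `C`. -/
def neighbors (A : E → Set ℝ) (C : Set E) (f : E) : Set E :=
  {e | e ∈ C ∧ e ≠ f ∧ lower A f < upper A e}

/-- An extended real, cut off to the interval `[-M, M]`. For a finite value this changes nothing
as soon as `M` is large; infinite values become `M` or `-M`. -/
noncomputable def truncate (M : ℝ) (x : EReal) : ℝ :=
  (max ((-M : ℝ) : EReal) (min (M : EReal) x)).toReal

end Limits

/-! ### Graphs -/

section Graphs

variable {V : Type u}

/-- `T` is (the edge set of) a spanning tree of `G`. -/
def IsSpanningTree (G : SimpleGraph V) (T : Finset G.edgeSet) : Prop :=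
  (SimpleGraph.fromEdgeSet (Subtype.val '' (T : Set G.edgeSet))).IsTree

/-- `T` is (the edge set of) a minimum spanning tree of `G` with respect to `w`. -/
def IsMST (G : SimpleGraph V) (w : G.edgeSet → ℝ) (T : Finset G.edgeSet) : Prop :=
  IsSpanningTree G T ∧ ∀ T', IsSpanningTree G T' → ∑ e ∈ T, w e ≤ ∑ e ∈ T', w e

/-- `T` is a minimum spanning tree for weights in the extended reals; infinite weights are treated
as real numbers of sufficiently large absolute value. -/
def IsLimitMST (G : SimpleGraph V) (l : G.edgeSet → EReal) (T : Finset G.edgeSet) : Prop :=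
  ∀ᶠ M : ℝ in atTop, IsMST G (fun e => truncate M (l e)) T

/-- `C` is the edge set of a cycle of `G`. -/
def IsCycleSet (G : SimpleGraph V) (C : Set G.edgeSet) : Prop :=
  ∃ (x : V) (c : G.Walk x x), c.IsCycle ∧ C = {e | (e : Sym2 V) ∈ c.edges}

/-- The edge set of the cycle that `f` closes with the spanning tree `T`. -/
def closedCycle (G : SimpleGraph V) (T : Finset G.edgeSet) (f : G.edgeSet) : Set G.edgeSet :=
  {e | ∃ C, IsCycleSet G C ∧ (∀ g ∈ C, g ∈ T ∨ g = f) ∧ f ∈ C ∧ e ∈ C}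

/-- A cactus: a connected graph in which any two different cycles share at most one vertex. -/
def IsCactus (G : SimpleGraph V) : Prop :=
  G.Connected ∧ ∀ (x y : V) (c : G.Walk x x) (d : G.Walk y y), c.IsCycle → d.IsCycle →
    {e | e ∈ c.edges} ≠ {e | e ∈ d.edges} →
    ∀ s t, s ∈ c.support → s ∈ d.support → t ∈ c.support → t ∈ d.support → s = t

/-- The graph consists of a single cycle. -/
def IsSingleCycle (G : SimpleGraph V) : Prop :=
  ∃ (x : V) (c : G.Walk x x), c.IsCycle ∧ (∀ y, y ∈ c.support) ∧ ∀ e ∈ G.edgeSet, e ∈ c.edges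

end Graphs

/-! ### The minimum spanning tree problem under edge uncertainty -/

/-- What is known to an algorithm in advance: a connected graph, for every edge an uncertainty set,
which is a singleton or a set containing neither its infimum nor its supremum, and query costs. -/
structure UncertaintyGraph (V : Type u) where
  graph : SimpleGraph V
  connected : graph.Connected
  sets : graph.edgeSet → Set ℝ
  sets_nonempty : ∀ e, (sets e).Nonempty
  sets_spec : ∀ e, (∃ x, sets e = {x}) ∨
    ∀ x ∈ sets e, (x : EReal) ≠ lower sets e ∧ (x : EReal) ≠ upper sets e
  queryCost : graph.edgeSet → ℝ
  queryCost_pos : ∀ e, 0 < queryCost e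

namespace UncertaintyGraph

variable {V : Type u} (P : UncertaintyGraph V)

/-- The type of edges. -/
abbrev Edge : Type u := P.graph.edgeSet

/-- The hidden weights `w` lie in the uncertainty sets. -/
def Realizes (w : P.Edge → ℝ) : Prop := ∀ e, w e ∈ P.sets e

/-- `Q` is a feasible query set for the hidden weights `w`. -/
def Feasible (w : P.Edge → ℝ) (Q : Finset P.Edge) : Prop :=
  ∃ T, IsSpanningTree P.graph T ∧
    ∀ w' : P.Edge → ℝ, (∀ e ∈ Q, w' e = w e) → (∀ e ∉ Q, w' e ∈ P.sets e) → IsMST P.graph w' T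

/-- The total query cost of `Q`. -/
noncomputable def cost (Q : Finset P.Edge) : ℝ := ∑ e ∈ Q, P.queryCost e

/-- The cost of an optimal query set. -/
noncomputable def opt (w : P.Edge → ℝ) : ℝ := sInf (P.cost '' {Q | P.Feasible w Q})

/-- A randomized algorithm for the input `P`: a random choice `A` of an adaptive query program, on a
probability space `Ω`, that almost surely queries a feasible set, whatever the hidden weights. -/
def IsRandomizedAlgorithm {Ω : Type*} [MeasurableSpace Ω] (μ : Measure Ω) {α : Type*}
    (A : Ω → Program P.Edge α) : Prop :=
  IsProbabilityMeasure μ ∧ ∀ w, P.Realizes w →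
    (∀ Q, MeasurableSet {ω | (A ω).queries w = Q}) ∧ ∀ᵐ ω ∂μ, P.Feasible w ((A ω).queries w)

/-- The expected query cost of a randomized algorithm for the hidden weights `w`. -/
noncomputable def expectedCost {Ω : Type*} [MeasurableSpace Ω] (μ : Measure Ω) {α : Type*}
    (A : Ω → Program P.Edge α) (w : P.Edge → ℝ) : ℝ :=
  ∫ ω, P.cost ((A ω).queries w) ∂μ

/-! ### The algorithm `Random_C` -/

/-- The information available after some queries: the set of queried edges, and the updated
uncertainty sets (the set of a queried edge is the singleton of its weight). -/
structure Knowledge where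
  queried : Finset P.Edge
  sets : P.Edge → Set ℝ

variable {P}

/-- The information before the first query. -/
def Knowledge.initial : P.Knowledge := ⟨∅, P.sets⟩

/-- The information after the query of `e` has revealed the weight `x`. -/
noncomputable def Knowledge.reveal (K : P.Knowledge) (e : P.Edge) (x : ℝ) : P.Knowledge :=
  ⟨insert e K.queried, Function.update K.sets e {x}⟩

/-- `T` is a lower limit tree. -/
def Knowledge.IsLowerTree (K : P.Knowledge) (T : Finset P.Edge) : Prop :=
  IsLimitMST P.graph (lower K.sets) T

/-- `T` is an upper limit tree. -/
def Knowledge.IsUpperTree (K : P.Knowledge) (T : Finset P.Edge) : Prop :=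
  IsLimitMST P.graph (upper K.sets) T

variable (P)

/-- A rule for the choices that the description of the algorithm leaves open. The choices depend
only on the information available when they are made, and not on the random number. -/
structure ChoiceRule where
  /-- The lower limit tree. -/
  lowerTree : P.Knowledge → Finset P.Edge
  /-- The upper limit tree. -/
  upperTree : P.Knowledge → Finset P.Edge
  lowerTree_spec : ∀ K : P.Knowledge, K.IsLowerTree (lowerTree K)
  upperTree_spec : ∀ K : P.Knowledge, K.IsUpperTree (upperTree K)
  /-- Ties are broken such that the two trees differ as little as possible. -/
  agree : ∀ (K : P.Knowledge) (T T' : Finset P.Edge), K.IsLowerTree T → K.IsUpperTree T' →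
    (lowerTree K \ upperTree K).card ≤ (T \ T').card
  /-- The order in which the edges outside the tree are treated. -/
  index : P.Knowledge → List P.Edge
  index_nodup : ∀ K, (index K).Nodup
  mem_index : ∀ K e, e ∈ index K ↔ e ∉ lowerTree K
  /-- An unqueried edge of `C` with largest upper limit, if `C` has an unqueried edge. -/
  pick : P.Knowledge → Set P.Edge → Option P.Edge
  pick_spec : ∀ K C, (∃ e ∈ C, e ∉ K.queried) → ∃ g, pick K C = some g ∧
    g ∈ C ∧ g ∉ K.queried ∧ ∀ e ∈ C, e ∉ K.queried → upper K.sets e ≤ upper K.sets g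

variable {P}

/-- Query all edges of a list. -/
noncomputable def queryAll : List P.Edge → P.Knowledge → Program P.Edge P.Knowledge
  | [], K => .done K
  | e :: l, K => .query e (fun x => queryAll l (K.reveal e x))

variable [Finite V]

/-- The neighbors of `f` on the cycle that it closes with `T`, with respect to `K`. -/
noncomputable def Knowledge.X (K : P.Knowledge) (T : Finset P.Edge) (f : P.Edge) : Finset P.Edge :=
  (Set.toFinite (neighbors K.sets (closedCycle P.graph T f) f)).toFinset

namespace ChoiceRule

variable (R : P.ChoiceRule)

/-- The preprocessing: as long as the limit trees `T_L` and `T_U` differ, query the edges of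
`T_L \ T_U`. The first argument bounds the number of rounds. -/
noncomputable def preprocessAux : ℕ → P.Knowledge → Program P.Edge P.Knowledge
  | 0, K => .done K
  | n + 1, K =>
    if R.lowerTree K = R.upperTree K then .done K
    else (queryAll (R.lowerTree K \ R.upperTree K).toList K).bind (preprocessAux n)

/-- The preprocessing. Every round queries a new edge, so there are at most `|E|` rounds. -/
noncomputable def preprocess : Program P.Edge P.Knowledge :=
  R.preprocessAux (Nat.card P.Edge) Knowledge.initial

/-- As long as no edge of the cycle `C` is always maximal, query an unqueried edge of `C` with
largest upper limit. The first argument bounds the number of rounds. -/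
noncomputable def finishAux (C : Set P.Edge) : ℕ → P.Knowledge → Program P.Edge P.Knowledge
  | 0, K => .done K
  | n + 1, K =>
    if ∃ g, AlwaysMaximal K.sets C g then .done K
    else match R.pick K C with
      | none => .done K
      | some g => .query g (fun x => finishAux C n (K.reveal g x))

/-- The while-loop on the cycle `C`; there are at most `|E|` rounds. -/
noncomputable def finish (C : Set P.Edge) (K : P.Knowledge) : Program P.Edge P.Knowledge :=
  R.finishAux C (Nat.card P.Edge) K

/-- The treatment of the cycle that `f` closes with the tree `T`, for the random number `b`. -/
noncomputable def treatCycle (b : ℝ) (T : Finset P.Edge) (K : P.Knowledge) (f : P.Edge) :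
    Program P.Edge P.Knowledge :=
  if K.X T f = ∅ then .done K
  else if b ≤ P.queryCost f ^ 2 / (P.queryCost f ^ 2 + P.cost (K.X T f) ^ 2) then
    (queryAll (K.X T f).toList K).bind (R.finish (closedCycle P.graph T f))
  else
    .query f (fun x => R.finish (closedCycle P.graph T f) (K.reveal f x))

/-- Treat the cycles closed by the edges of a list, one after the other. -/
noncomputable def treatCycles (b : ℝ) (T : Finset P.Edge) :
    List P.Edge → P.Knowledge → Program P.Edge P.Knowledge
  | [], K => .done K
  | f :: l, K => (R.treatCycle b T K f).bind (treatCycles b T l)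

/-- The algorithm `Random_C` for the random number `b`. -/
noncomputable def randomC (b : ℝ) : Program P.Edge P.Knowledge :=
  R.preprocess.bind (fun K => R.treatCycles b (R.lowerTree K) (R.index K) K)

end ChoiceRule

end UncertaintyGraph

/-- The uniform distribution on `[0, 1]`. -/
noncomputable def uniform01 : Measure ℝ := volume.restrict (Set.Icc 0 1)

/-- The ratio `1 + q_X q_f / (q_X ^ 2 + q_f ^ 2)`. -/
noncomputable def cycleRatio (qX qf : ℝ) : ℝ := 1 + qX * qf / (qX ^ 2 + qf ^ 2)

end MSTU

/-! In a cactus two different cycles never share an edge, so the spanning trees are exactly the edge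
sets that omit one edge of every cycle and nothing else (`IsCactus.isSpanningTree_iff`). The problem
therefore splits into the cycles. A spanning tree is minimum iff it omits an edge of maximal weight
from each cycle (`IsCactus.isMST_iff`, `IsCactus.isLimitMST_iff`), and a query set is feasible iff
it leaves every cycle with an always maximal edge (`feasible_iff`).

The preprocessing queries only edges that lie in every feasible set
(`Realizes.mem_of_largest_upper`), so it is never wasteful. Afterwards the edge `f` omitted on a
cycle has both the largest lower and the largest upper limit, and a feasible `Q` contains `f` or all
of `X = X(f)` (`Realizes.mem_or_mem`). Write `x` and `y` for the costs of `X` and `f`. If `f ∉ Q`,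
then querying `X` suffices and costs `x`, while starting with `f` costs at most `x + y`. If `f ∈ Q`,
then starting with `f` leads only to queries in `Q` (`Realizes.mem_of_largest_unqueried`), while
starting with `X` costs at most `x + y`. The extreme cases are that `Q` contains exactly `X`, or
exactly `f`, among these edges. Starting with `X` with probability `p = y²/(x²+y²)` gives expected
costs `x + (1-p)y` and `y + px`, both equal to `1 + xy/(x²+y²)` times the share of `Q`
(`integral_treatBound_le`). This ratio is at most `3/2` because `2xy ≤ x² + y²`. The shares of the
cycles and the preprocessed edges are disjoint parts of `Q`, so the bounds add up
(`ChoiceRule.expectedCost_le`).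

For the lower bound, a triangle has edges `f`, `e`, `h` with sets `(1,3)`, `(0,2)`, `{0}`. For one
choice of weights `{e}` is the unique optimum, for another it is `{f}`. The first query of a program
cannot be right for both (`three_le_cost`), so the two costs add up to at least 3. The same triangle
with costs `a` and `c` attains the ratio on cycles (`IsTriangle.expectedCost_eq`). -/

namespace MSTU

/-! ### Cycles, spanning trees and minimum spanning trees of a cactus. -/

section CycleStructure

variable {V : Type u} {G : SimpleGraph V}

/-- The spanning subgraph of `G` with edge set `S`. -/
abbrev edgeGraph (S : Set G.edgeSet) : SimpleGraph V := SimpleGraph.fromEdgeSet (Subtype.val '' S)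

theorem edgeGraph_adj {S : Set G.edgeSet} {x y : V} :
    (edgeGraph S).Adj x y ↔ ∃ h : s(x, y) ∈ G.edgeSet, (⟨s(x, y), h⟩ : G.edgeSet) ∈ S := by
  rw [SimpleGraph.fromEdgeSet_adj]
  constructor
  · rintro ⟨⟨e, he, hxy⟩, -⟩
    exact ⟨hxy ▸ e.2, by convert he; exact hxy.symm⟩
  · rintro ⟨h, hS⟩
    exact ⟨⟨_, hS, rfl⟩, SimpleGraph.Adj.ne h⟩

theorem edgeGraph_le (S : Set G.edgeSet) : edgeGraph S ≤ G := by
  intro x y h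
  obtain ⟨h, -⟩ := edgeGraph_adj.1 h
  exact h

theorem edgeGraph_mono {S S' : Set G.edgeSet} (h : S ⊆ S') : edgeGraph S ≤ edgeGraph S' := by
  intro x y hxy
  obtain ⟨h1, h2⟩ := edgeGraph_adj.1 hxy
  exact edgeGraph_adj.2 ⟨h1, h h2⟩

/-- The equation in `IsCycleSet` compares sets of unordered pairs, with `C` coerced; here it becomes
an equation between sets of edges of `G`. -/
theorem isCycleSet_iff {C : Set G.edgeSet} : IsCycleSet G C ↔
    ∃ (x : V) (c : G.Walk x x), c.IsCycle ∧ C = {e : G.edgeSet | (e : Sym2 V) ∈ c.edges} := by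
  refine exists_congr fun x => exists_congr fun c => and_congr_right fun _ => ?_
  have h : ({e | e ∈ c.edges} : Set (Sym2 V)) =
      Subtype.val '' {e : G.edgeSet | (e : Sym2 V) ∈ c.edges} := by
    ext e
    exact ⟨fun he => ⟨⟨e, c.edges_subset_edgeSet he⟩, he, rfl⟩, by rintro ⟨e, he, rfl⟩; exact he⟩
  rw [h]
  exact Subtype.val_injective.image_injective.eq_iff

theorem IsCycleSet.nonempty {C : Set G.edgeSet} (hC : IsCycleSet G C) : C.Nonempty := by
  obtain ⟨x, c, hc, rfl⟩ := isCycleSet_iff.1 hC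
  cases c with
  | nil => exact absurd rfl hc.ne_nil
  | cons h p => exact ⟨⟨s(_, _), h⟩, List.mem_cons_self⟩

/-- Two cycles of a cactus with a common edge coincide. -/
theorem IsCactus.eq_of_mem (hG : IsCactus G) {C D : Set G.edgeSet} (hC : IsCycleSet G C)
    (hD : IsCycleSet G D) {e : G.edgeSet} (heC : e ∈ C) (heD : e ∈ D) : C = D := by
  obtain ⟨x, c, hc, rfl⟩ := isCycleSet_iff.1 hC
  obtain ⟨y, d, hd, rfl⟩ := isCycleSet_iff.1 hD
  by_cases h : {e | e ∈ c.edges} = {e | e ∈ d.edges}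
  · ext g
    exact Set.ext_iff.1 h g
  · obtain ⟨⟨s, t⟩, he⟩ := e
    have h1 := hG.2 x y c d hc hd h s t (c.fst_mem_support_of_mem_edges heC)
      (d.fst_mem_support_of_mem_edges heD) (c.snd_mem_support_of_mem_edges heC)
      (d.snd_mem_support_of_mem_edges heD)
    exact absurd h1 (SimpleGraph.Adj.ne he)

/-- A spanning tree misses an edge of every cycle. -/
theorem IsCycleSet.exists_notMem {C : Set G.edgeSet} (hC : IsCycleSet G C) {T : Finset G.edgeSet}
    (hT : IsSpanningTree G T) : ∃ e ∈ C, e ∉ T := by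
  by_contra! h
  obtain ⟨x, c, hc, rfl⟩ := isCycleSet_iff.1 hC
  have hq : ∀ e ∈ c.edges, e ∈ (edgeGraph (T : Set G.edgeSet)).edgeSet := by
    rintro ⟨a, b⟩ he
    have := c.edges_subset_edgeSet he
    exact edgeGraph_adj.2 ⟨this, h ⟨_, this⟩ he⟩
  exact hT.isAcyclic _ (hc.transfer hq)

/-- The end vertices of an edge of a cycle are connected by the rest of the cycle. -/
theorem IsCycleSet.reachable {C : Set G.edgeSet} (hC : IsCycleSet G C) {x y : V}
    (h : s(x, y) ∈ G.edgeSet) (hxy : (⟨s(x, y), h⟩ : G.edgeSet) ∈ C) :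
    (edgeGraph (C \ {⟨s(x, y), h⟩})).Reachable x y := by
  obtain ⟨z, c, hc, rfl⟩ := isCycleSet_iff.1 hC
  have hq : ∀ e ∈ c.edges, e ∈ (edgeGraph {e : G.edgeSet | (e : Sym2 V) ∈ c.edges}).edgeSet := by
    rintro ⟨a, b⟩ he
    exact edgeGraph_adj.2 ⟨c.edges_subset_edgeSet he, he⟩
  have h1 := (SimpleGraph.adj_and_reachable_delete_edges_iff_exists_cycle
    (G := edgeGraph {e : G.edgeSet | (e : Sym2 V) ∈ c.edges}) (v := x) (w := y)).2
    ⟨z, _, hc.transfer hq, by rw [SimpleGraph.Walk.edges_transfer]; exact hxy⟩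
  refine h1.2.mono ?_
  intro a b hab
  rw [SimpleGraph.deleteEdges_adj] at hab
  obtain ⟨h2, h3⟩ := edgeGraph_adj.1 hab.1
  refine edgeGraph_adj.2 ⟨h2, h3, fun h4 => hab.2 ?_⟩
  exact congrArg Subtype.val h4

/-- An edge outside of a spanning tree closes a cycle with it. -/
theorem IsSpanningTree.exists_cycle {T : Finset G.edgeSet} (hT : IsSpanningTree G T)
    {f : G.edgeSet} (hf : f ∉ T) : ∃ C, IsCycleSet G C ∧ f ∈ C ∧ ∀ e ∈ C, e ≠ f → e ∈ T := by
  obtain ⟨⟨x, y⟩, h⟩ := f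
  have h : G.Adj x y := h
  obtain ⟨p, hp⟩ := (hT.connected.preconnected y x).exists_isPath
  have hle := edgeGraph_le (T : Set G.edgeSet)
  have key : ∀ e : G.edgeSet, (e : Sym2 V) ∈ (p.mapLe hle).edges → e ∈ T := by
    rintro ⟨⟨a, b⟩, hab⟩ he
    rw [SimpleGraph.Walk.edges_mapLe_eq_edges] at he
    obtain ⟨_, h2⟩ := edgeGraph_adj.1 (p.edges_subset_edgeSet he)
    exact h2
  refine ⟨_, isCycleSet_iff.2 ⟨x, SimpleGraph.Walk.cons h (p.mapLe hle), ?_, rfl⟩, ?_, ?_⟩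
  · rw [SimpleGraph.Walk.cons_isCycle_iff]
    exact ⟨hp.mapLe hle, fun he => hf (key _ he)⟩
  · exact List.mem_cons_self
  · intro e he hne
    rcases List.mem_cons.1 he with he | he
    · exact absurd (Subtype.ext he) hne
    · exact key e he

/-- The spanning trees of a cactus are the sets that miss exactly one edge of every cycle, and no
other edges. -/
theorem IsCactus.isSpanningTree_iff (hG : IsCactus G) (T : Finset G.edgeSet) :
    IsSpanningTree G T ↔ (∀ C, IsCycleSet G C → ∃ f ∈ C, f ∉ T ∧ ∀ e ∈ C, e ≠ f → e ∈ T) ∧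
      ∀ f ∉ T, ∃ C, IsCycleSet G C ∧ f ∈ C := by
  constructor
  · intro hT
    refine ⟨fun C hC => ?_, fun f hf => ?_⟩
    · obtain ⟨f, hfC, hf⟩ := hC.exists_notMem hT
      obtain ⟨D, hD, hfD, h⟩ := hT.exists_cycle hf
      obtain rfl := hG.eq_of_mem hC hD hfC hfD
      exact ⟨f, hfC, hf, h⟩
    · obtain ⟨C, hC, hfC, -⟩ := hT.exists_cycle hf
      exact ⟨C, hC, hfC⟩
  · rintro ⟨h1, h2⟩
    -- An omitted edge lies on a cycle whose other edges all belong to `T`, so the rest of the cycle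
    -- connects its ends.
    have hreach : ∀ x y, G.Adj x y → (edgeGraph (T : Set G.edgeSet)).Reachable x y := by
      intro x y hxy
      by_cases hT : (⟨s(x, y), hxy⟩ : G.edgeSet) ∈ T
      · exact SimpleGraph.Adj.reachable (edgeGraph_adj.2 ⟨hxy, hT⟩)
      · obtain ⟨C, hC, hmem⟩ := h2 _ hT
        obtain ⟨f, hfC, hf, h⟩ := h1 C hC
        have hff : (⟨s(x, y), hxy⟩ : G.edgeSet) = f := by
          by_contra hne
          exact hT (h _ hmem hne)
        refine (hC.reachable hxy hmem).mono (edgeGraph_mono ?_)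
        rintro e ⟨heC, hne⟩
        exact h e heC (by rw [← hff]; exact hne)
    have hne : Nonempty V := hG.1.nonempty
    refine ⟨⟨fun x y => ?_⟩, ?_⟩
    · obtain ⟨p⟩ := hG.1.preconnected x y
      induction p with
      | nil => exact SimpleGraph.Reachable.refl _
      | cons h p ih => exact (hreach _ _ h).trans ih
    · intro x c hc
      have hle := edgeGraph_le (T : Set G.edgeSet)
      obtain ⟨f, hfC, hf, -⟩ := h1 _ (isCycleSet_iff.2 ⟨x, c.mapLe hle, hc.mapLe hle, rfl⟩)
      apply hf
      obtain ⟨⟨a, b⟩, hab⟩ := f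
      simp only [Set.mem_ofPred_eq, SimpleGraph.Walk.edges_mapLe_eq_edges] at hfC
      obtain ⟨_, h2⟩ := edgeGraph_adj.1 (c.edges_subset_edgeSet hfC)
      exact h2

/-- Exchange: the edge of a cycle that is missing in a spanning tree may be chosen freely. -/
theorem IsCactus.exchange (hG : IsCactus G) {T : Finset G.edgeSet} (hT : IsSpanningTree G T)
    {C : Set G.edgeSet} (hC : IsCycleSet G C) {f g : G.edgeSet} (hfC : f ∈ C) (hf : f ∉ T)
    (hgC : g ∈ C) : IsSpanningTree G ((insert f T).erase g) := by
  rw [hG.isSpanningTree_iff] at hT ⊢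
  refine ⟨fun D hD => ?_, fun e he => ?_⟩
  · obtain ⟨f', hf'D, hf', h⟩ := hT.1 D hD
    by_cases hDC : D = C
    · subst hDC
      have hff : f = f' := by
        by_contra hne
        exact hf (h f hfC hne)
      subst hff
      refine ⟨g, hgC, by simp, fun e he hne => ?_⟩
      rw [Finset.mem_erase, Finset.mem_insert]
      by_cases hef : e = f
      · exact ⟨hne, Or.inl hef⟩
      · exact ⟨hne, Or.inr (h e he hef)⟩
    · have hdis : ∀ e ∈ D, e ∉ C := fun e he he' => hDC (hG.eq_of_mem hD hC he he')
      refine ⟨f', hf'D, ?_, fun e he hne => ?_⟩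
      · rw [Finset.mem_erase, Finset.mem_insert]
        rintro ⟨-, h1 | h1⟩
        · exact hdis _ hf'D (h1 ▸ hfC)
        · exact hf' h1
      · rw [Finset.mem_erase, Finset.mem_insert]
        exact ⟨fun h1 => hdis _ he (h1 ▸ hgC), Or.inr (h e he hne)⟩
  · by_cases heg : e = g
    · exact ⟨C, hC, heg ▸ hgC⟩
    · refine hT.2 e fun h => he ?_
      rw [Finset.mem_erase, Finset.mem_insert]
      exact ⟨heg, Or.inr h⟩

theorem IsCactus.eq_of_notMem (hG : IsCactus G) {T : Finset G.edgeSet} (hT : IsSpanningTree G T)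
    {C : Set G.edgeSet} (hC : IsCycleSet G C) {f g : G.edgeSet} (hfC : f ∈ C) (hf : f ∉ T)
    (hgC : g ∈ C) (hg : g ∉ T) : f = g := by
  obtain ⟨e, -, -, h⟩ := ((hG.isSpanningTree_iff T).1 hT).1 C hC
  have h1 : f = e := by
    by_contra hne
    exact hf (h f hfC hne)
  have h2 : g = e := by
    by_contra hne
    exact hg (h g hgC hne)
  rw [h1, h2]

theorem IsCactus.closedCycle_eq (hG : IsCactus G) {T : Finset G.edgeSet} (hT : IsSpanningTree G T)
    {C : Set G.edgeSet} (hC : IsCycleSet G C) {f : G.edgeSet} (hfC : f ∈ C) (hf : f ∉ T) :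
    closedCycle G T f = C := by
  ext e
  constructor
  · rintro ⟨D, hD, -, hfD, he⟩
    rwa [hG.eq_of_mem hC hD hfC hfD]
  · intro he
    refine ⟨C, hC, fun g hg => ?_, hfC, he⟩
    by_cases hgT : g ∈ T
    · exact Or.inl hgT
    · exact Or.inr (hG.eq_of_notMem hT hC hg hgT hfC hf)

/-- Minimum spanning trees of a cactus miss an edge of maximal weight of every cycle. -/
theorem IsCactus.isMST_iff (hG : IsCactus G) (w : G.edgeSet → ℝ) (T : Finset G.edgeSet) :
    IsMST G w T ↔ IsSpanningTree G T ∧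
      ∀ C, IsCycleSet G C → ∀ f ∈ C, f ∉ T → ∀ e ∈ C, w e ≤ w f := by
  constructor
  · rintro ⟨hT, hmin⟩
    refine ⟨hT, fun C hC f hfC hf e heC => ?_⟩
    by_cases hef : e = f
    · rw [hef]
    have heT : e ∈ T := by
      by_contra he
      exact hef (hG.eq_of_notMem hT hC heC he hfC hf)
    have h := hmin _ (hG.exchange hT hC hfC hf heC)
    have h1 := Finset.add_sum_erase (insert f T) w (Finset.mem_insert_of_mem heT)
    rw [Finset.sum_insert hf] at h1
    linarith
  · rintro ⟨hT, h⟩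
    refine ⟨hT, fun T' hT' => ?_⟩
    -- The cycle on which `T'` omits `e` has its `T`-omitted edge in `T'`. This matching `φ` is a
    -- bijection from `T \ T'` to `T' \ T` that does not decrease weights.
    have key : ∀ T T' : Finset G.edgeSet, IsSpanningTree G T → IsSpanningTree G T' →
        ∀ e ∈ T \ T', ∃ f ∈ T' \ T, ∃ C, IsCycleSet G C ∧ e ∈ C ∧ f ∈ C := by
      intro T T' hT hT' e he
      rw [Finset.mem_sdiff] at he
      obtain ⟨C, hC, heC⟩ := ((hG.isSpanningTree_iff T').1 hT').2 e he.2
      obtain ⟨f, hfC, hf, -⟩ := ((hG.isSpanningTree_iff T).1 hT).1 C hC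
      refine ⟨f, ?_, C, hC, heC, hfC⟩
      rw [Finset.mem_sdiff]
      refine ⟨?_, hf⟩
      by_contra hf'
      exact hf (hG.eq_of_notMem hT' hC hfC hf' heC he.2 ▸ he.1)
    choose! φ hφ hφ' using key T T' hT hT'
    have hinj : ∀ e ∈ T \ T', ∀ e' ∈ T \ T', φ e = φ e' → e = e' := by
      intro e he e' he' heq
      obtain ⟨C, hC, heC, hfC⟩ := hφ' e he
      obtain ⟨C', hC', heC', hfC'⟩ := hφ' e' he'
      obtain rfl := hG.eq_of_mem hC hC' hfC (heq ▸ hfC')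
      exact hG.eq_of_notMem hT' hC heC (Finset.mem_sdiff.1 he).2 heC' (Finset.mem_sdiff.1 he').2
    have hsurj : ∀ f ∈ T' \ T, ∃ e, ∃ _ : e ∈ T \ T', φ e = f := by
      intro f hf
      obtain ⟨e, he, C, hC, hfC, heC⟩ := key T' T hT' hT f hf
      refine ⟨e, he, ?_⟩
      obtain ⟨C', hC', heC', hfC'⟩ := hφ' e he
      obtain rfl := hG.eq_of_mem hC hC' heC heC'
      exact hG.eq_of_notMem hT hC hfC' (Finset.mem_sdiff.1 (hφ e he)).2 hfC
        (Finset.mem_sdiff.1 hf).2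
    have h1 : ∑ e ∈ T \ T', w e ≤ ∑ f ∈ T' \ T, w f := by
      calc ∑ e ∈ T \ T', w e ≤ ∑ e ∈ T \ T', w (φ e) := by
            refine Finset.sum_le_sum fun e he => ?_
            obtain ⟨C, hC, heC, hfC⟩ := hφ' e he
            exact h C hC _ hfC (Finset.mem_sdiff.1 (hφ e he)).2 e heC
        _ = ∑ f ∈ T' \ T, w f := Finset.sum_bij (fun e _ => φ e) hφ
            (fun e he e' he' => hinj e he e' he') hsurj (fun _ _ => rfl)
    have h2 := Finset.sum_inter_add_sum_sdiff T T' w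
    have h3 := Finset.sum_inter_add_sum_sdiff T' T w
    rw [Finset.inter_comm] at h3
    linarith

/-! ### Limit trees for extended real weights. -/

theorem truncate_mono (M : ℝ) : Monotone (truncate M) := by
  intro x y h
  refine EReal.toReal_le_toReal ?_ ?_ ?_
  · exact max_le_max le_rfl (min_le_min le_rfl h)
  · exact ne_of_gt (lt_of_lt_of_le (EReal.bot_lt_coe _) (le_max_left _ _))
  · exact ne_of_lt (max_lt (EReal.coe_lt_top _) (lt_of_le_of_lt (min_le_left _ _) (EReal.coe_lt_top _)))

theorem truncate_coe {M r : ℝ} (h1 : -M ≤ r) (h2 : r ≤ M) : truncate M r = r := by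
  rw [truncate, min_eq_right (EReal.coe_le_coe_iff.2 h2), max_eq_right (EReal.coe_le_coe_iff.2 h1),
    EReal.toReal_coe]

theorem eventually_truncate_lt {x y : EReal} (h : x < y) :
    ∀ᶠ M : ℝ in atTop, truncate M x < truncate M y := by
  obtain ⟨r, hxr, hry⟩ := EReal.lt_iff_exists_real_btwn.1 h
  obtain ⟨s, hrs, hsy⟩ := EReal.lt_iff_exists_real_btwn.1 hry
  rw [EReal.coe_lt_coe_iff] at hrs
  filter_upwards [eventually_ge_atTop |r|, eventually_ge_atTop |s|] with M h1 h2
  calc truncate M x ≤ truncate M r := truncate_mono M hxr.le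
    _ = r := truncate_coe (abs_le.1 h1).1 (abs_le.1 h1).2
    _ < s := hrs
    _ = truncate M s := (truncate_coe (abs_le.1 h2).1 (abs_le.1 h2).2).symm
    _ ≤ truncate M y := truncate_mono M hsy.le

/-- On a cactus minimality depends only on comparisons of weights. Truncation is monotone, and it
preserves a given strict inequality once `M` exceeds two reals strictly in between, so the
comparisons can be made in `EReal`. -/
theorem IsCactus.isLimitMST_iff (hG : IsCactus G) (l : G.edgeSet → EReal) (T : Finset G.edgeSet) :
    IsLimitMST G l T ↔ IsSpanningTree G T ∧
      ∀ C, IsCycleSet G C → ∀ f ∈ C, f ∉ T → ∀ e ∈ C, l e ≤ l f := by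
  simp only [IsLimitMST, hG.isMST_iff]
  constructor
  · intro h
    refine ⟨h.exists.choose_spec.1, fun C hC f hfC hf e heC => ?_⟩
    by_contra! hlt
    obtain ⟨M, h1, h2⟩ := (h.and (eventually_truncate_lt hlt)).exists
    exact absurd (h1.2 C hC f hfC hf e heC) (not_le.2 h2)
  · rintro ⟨hT, h⟩
    exact Eventually.of_forall fun M => ⟨hT, fun C hC f hfC hf e heC =>
      truncate_mono M (h C hC f hfC hf e heC)⟩

/-- Spanning trees that miss prescribed edges of the cycles. -/
theorem IsCactus.exists_isSpanningTree [Finite V] (hG : IsCactus G)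
    (p : ∀ C : Set G.edgeSet, IsCycleSet G C → G.edgeSet) (hp : ∀ C hC, p C hC ∈ C) :
    ∃ T, IsSpanningTree G T ∧ ∀ C hC, ∀ f ∈ C, f ∉ T → f = p C hC := by
  -- The tree consists of all edges not selected by `p`; an edge of `C` selected for any cycle is
  -- the one selected for `C`, since cycles are edge-disjoint.
  have hfin : {e | ∀ C hC, e ≠ p C hC}.Finite := Set.toFinite _
  have hmem : ∀ C hC, ∀ f ∈ C, f ∉ hfin.toFinset → f = p C hC := by
    intro C hC f hfC hf
    simp only [Set.Finite.mem_toFinset, Set.mem_ofPred_eq, not_forall, not_not] at hf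
    obtain ⟨D, hD, rfl⟩ := hf
    obtain rfl := hG.eq_of_mem hC hD hfC (hp D hD)
    rfl
  refine ⟨hfin.toFinset, (hG.isSpanningTree_iff _).2
    ⟨fun C hC => ⟨p C hC, hp C hC, ?_, ?_⟩, ?_⟩, hmem⟩
  · simp only [Set.Finite.mem_toFinset, Set.mem_ofPred_eq, not_forall, not_not]
    exact ⟨C, hC, rfl⟩
  · intro e he hne
    by_contra h
    exact hne (hmem C hC e he h)
  · intro f hf
    simp only [Set.Finite.mem_toFinset, Set.mem_ofPred_eq, not_forall, not_not] at hf
    obtain ⟨D, hD, rfl⟩ := hf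
    exact ⟨D, hD, hp D hD⟩

theorem IsCactus.exists_isLimitMST [Finite V] (hG : IsCactus G) (l : G.edgeSet → EReal) :
    ∃ T, IsLimitMST G l T := by
  have h : ∀ C : Set G.edgeSet, IsCycleSet G C → ∃ f ∈ C, ∀ e ∈ C, l e ≤ l f := fun C hC =>
    Set.exists_max_image C l (Set.toFinite C) hC.nonempty
  choose p hp hp' using h
  obtain ⟨T, hT, h⟩ := hG.exists_isSpanningTree p hp
  refine ⟨T, (hG.isLimitMST_iff l T).2 ⟨hT, fun C hC f hfC hf e heC => ?_⟩⟩
  rw [h C hC f hfC hf]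
  exact hp' C hC e heC

/-! ### Graphs that are a single cycle. -/

/-- In a graph that consists of a single cycle, every cycle contains all edges. -/
theorem IsSingleCycle.eq_univ [Finite V] (hG : IsSingleCycle G) {C : Set G.edgeSet}
    (hC : IsCycleSet G C) : C = Set.univ := by
  obtain ⟨x, c, hc, hsupp, hedge⟩ := hG
  have := Fintype.ofFinite V
  have hconn : G.Connected := by
    refine (SimpleGraph.connected_iff_exists_forall_reachable G).2 ⟨x, fun y => ?_⟩
    exact ⟨c.takeUntil y (hsupp y)⟩
  have hcardV : Nat.card V = c.length := by
    have h1 : c.support.tail.toFinset = Finset.univ := by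
      ext y
      simp only [List.mem_toFinset, Finset.mem_univ, iff_true]
      rcases c.mem_support_iff.1 (hsupp y) with rfl | h
      · exact c.end_mem_tail_support hc.not_nil
      · exact h
    have h2 := List.toFinset_card_of_nodup hc.support_nodup
    rw [h1] at h2
    simp at h2
    rw [Nat.card_eq_fintype_card, h2]
  have hcardE : G.edgeSet.ncard = c.length := by
    have h1 : G.edgeSet = (c.edges.toFinset : Set (Sym2 V)) := by
      ext e
      simp only [List.coe_toFinset, Set.mem_ofPred_eq]
      exact ⟨hedge e, fun h => c.edges_subset_edgeSet h⟩
    rw [h1, Set.ncard_coe_finset, List.toFinset_card_of_nodup hc.edges_nodup,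
      SimpleGraph.Walk.length_edges]
  rw [Set.eq_univ_iff_forall]
  rintro ⟨⟨a, b⟩, he⟩
  obtain ⟨y, d, hd, rfl⟩ := isCycleSet_iff.1 hC
  by_contra hne
  -- The edge avoided by `d` lies on the spanning cycle `c`. Deleting it leaves a connected graph
  -- with one edge fewer than vertices, that is a tree, which would still contain `d`.
  have hbr : ¬ G.IsBridge s(a, b) := by
    rw [SimpleGraph.isBridge_iff_forall_cycle_notMem he]
    exact fun h => h c hc (hedge _ he)
  have htree : (G.deleteEdges {s(a, b)}).IsTree := by
    rw [SimpleGraph.isTree_iff_connected_and_card]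
    refine ⟨hconn.connected_delete_edge_of_not_isBridge hbr, ?_⟩
    rw [SimpleGraph.edgeSet_deleteEdges, hcardV, ← hcardE]
    exact Set.ncard_sdiff_singleton_add_one he
  have hq : ∀ e ∈ d.edges, e ∈ (G.deleteEdges {s(a, b)}).edgeSet := by
    intro e hed
    rw [SimpleGraph.edgeSet_deleteEdges]
    refine ⟨d.edges_subset_edgeSet hed, fun h => hne ?_⟩
    rw [Set.mem_singleton_iff.1 h] at hed
    exact hed
  exact htree.isAcyclic _ (hd.transfer hq)

theorem IsSingleCycle.isCactus [Finite V] (hG : IsSingleCycle G) : IsCactus G := by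
  refine ⟨?_, fun x y c d hc hd hne => ?_⟩
  · obtain ⟨x, c, hc, hsupp, hedge⟩ := hG
    refine (SimpleGraph.connected_iff_exists_forall_reachable G).2 ⟨x, fun y => ?_⟩
    exact ⟨c.takeUntil y (hsupp y)⟩
  · exfalso
    apply hne
    have h : ∀ (x : V) (c : G.Walk x x), c.IsCycle → {e | e ∈ c.edges} = G.edgeSet := by
      intro x c hc
      have h1 := hG.eq_univ (isCycleSet_iff.2 ⟨x, c, hc, rfl⟩)
      ext e
      exact ⟨fun he => c.edges_subset_edgeSet he,
        fun he => Set.eq_univ_iff_forall.1 h1 ⟨e, he⟩⟩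
    rw [h x c hc, h y d hd]

theorem IsSingleCycle.isCycleSet_univ (hG : IsSingleCycle G) : IsCycleSet G Set.univ := by
  obtain ⟨x, c, hc, hsupp, hedge⟩ := hG
  refine isCycleSet_iff.2 ⟨x, c, hc, ?_⟩
  ext e
  simpa using hedge e e.2

end CycleStructure

/-! ### Limits after queries, always maximal edges and forced queries. -/

namespace UncertaintyGraph

variable {V : Type u} {P : UncertaintyGraph V}

/-- The uncertainty sets after the query of all edges in `S`, for the hidden weights `w`. -/
noncomputable def revealed (P : UncertaintyGraph V) (w : P.Edge → ℝ) (S : Finset P.Edge) :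
    P.Edge → Set ℝ :=
  fun e => if e ∈ S then {w e} else P.sets e

/-- The information after the query of all edges in `S`, for the hidden weights `w`. -/
noncomputable def known (P : UncertaintyGraph V) (w : P.Edge → ℝ) (S : Finset P.Edge) :
    P.Knowledge :=
  ⟨S, P.revealed w S⟩

theorem known_empty (w : P.Edge → ℝ) : P.known w ∅ = Knowledge.initial := by
  have h : P.revealed w ∅ = P.sets := by
    funext e
    simp [revealed]
  rw [known, h]
  rfl

/-- The information depends only on the set of queried edges, not on their order, so every state
reached from the initial one has the form `known w S`. -/
theorem reveal_known (w : P.Edge → ℝ) (S : Finset P.Edge) (e : P.Edge) :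
    (P.known w S).reveal e (w e) = P.known w (insert e S) := by
  have h : Function.update (P.revealed w S) e {w e} = P.revealed w (insert e S) := by
    funext g
    by_cases hg : g = e
    · subst hg
      simp [revealed]
    · simp [revealed, hg]
  simp only [Knowledge.reveal, known, h]

section Limits

variable {w : P.Edge → ℝ} {S Q : Finset P.Edge} {e f g : P.Edge} {C : Set P.Edge}

theorem lower_of_mem (h : e ∈ S) : lower (P.revealed w S) e = w e := by
  simp [lower, revealed, h]

theorem upper_of_mem (h : e ∈ S) : upper (P.revealed w S) e = w e := by
  simp [upper, revealed, h]

theorem revealed_congr (h : e ∈ S ↔ e ∈ Q) : P.revealed w S e = P.revealed w Q e := by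
  simp only [revealed, h]

theorem lower_congr (h : e ∈ S ↔ e ∈ Q) :
    lower (P.revealed w S) e = lower (P.revealed w Q) e := by
  simp only [lower, revealed_congr h]

theorem upper_congr (h : e ∈ S ↔ e ∈ Q) :
    upper (P.revealed w S) e = upper (P.revealed w Q) e := by
  simp only [upper, revealed_congr h]

theorem lower_eq_of_notMem (h : e ∉ Q) (hSQ : S ⊆ Q) :
    lower (P.revealed w Q) e = lower (P.revealed w S) e :=
  lower_congr (iff_of_false h fun h' => h (hSQ h'))

theorem upper_eq_of_notMem (h : e ∉ Q) (hSQ : S ⊆ Q) :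
    upper (P.revealed w Q) e = upper (P.revealed w S) e :=
  upper_congr (iff_of_false h fun h' => h (hSQ h'))

theorem Realizes.mem_revealed (hw : P.Realizes w) (S : Finset P.Edge) (e : P.Edge) :
    w e ∈ P.revealed w S e := by
  rw [revealed]
  split_ifs
  · rfl
  · exact hw e

theorem Realizes.lower_le (hw : P.Realizes w) (S : Finset P.Edge) (e : P.Edge) :
    lower (P.revealed w S) e ≤ w e :=
  sInf_le ⟨_, hw.mem_revealed S e, rfl⟩

theorem Realizes.le_upper (hw : P.Realizes w) (S : Finset P.Edge) (e : P.Edge) :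
    (w e : EReal) ≤ upper (P.revealed w S) e :=
  le_sSup ⟨_, hw.mem_revealed S e, rfl⟩

theorem Realizes.lower_le_upper (hw : P.Realizes w) (S : Finset P.Edge) (e : P.Edge) :
    lower (P.revealed w S) e ≤ upper (P.revealed w S) e :=
  (hw.lower_le S e).trans (hw.le_upper S e)

/-- Here the assumption on the uncertainty sets enters: a nontrivial set contains neither of its
limits, so both inequalities are strict. -/
theorem Realizes.strict (hw : P.Realizes w)
    (h : lower (P.revealed w S) e < upper (P.revealed w S) e) :
    e ∉ S ∧ lower (P.revealed w S) e < w e ∧ w e < upper (P.revealed w S) e := by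
  have heS : e ∉ S := by
    intro heS
    rw [lower_of_mem heS, upper_of_mem heS] at h
    exact lt_irrefl _ h
  have hA : P.revealed w S e = P.sets e := by simp [revealed, heS]
  have hl : lower (P.revealed w S) e = lower P.sets e := by simp only [lower, hA]
  have hu : upper (P.revealed w S) e = upper P.sets e := by simp only [upper, hA]
  refine ⟨heS, ?_⟩
  rcases P.sets_spec e with ⟨x, hx⟩ | h'
  · rw [hl, hu] at h
    simp [lower, upper, hx] at h
  · have h1 := h' _ (hw e)
    refine ⟨lt_of_le_of_ne (hw.lower_le S e) ?_, lt_of_le_of_ne (hw.le_upper S e) ?_⟩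
    · rw [hl]
      exact h1.1.symm
    · rw [hu]
      exact h1.2

/-- An attained upper limit is the limit of a trivial set. -/
theorem Realizes.lower_eq_of_upper_le (hw : P.Realizes w)
    (h : upper (P.revealed w S) e ≤ w e) : lower (P.revealed w S) e = w e := by
  rcases (hw.lower_le_upper S e).lt_or_eq with h1 | h1
  · exact absurd (hw.strict h1).2.2 (not_lt.2 h)
  · exact le_antisymm (hw.lower_le S e) (h1 ▸ hw.le_upper S e)

theorem Realizes.lower_mono (hw : P.Realizes w) (hSQ : S ⊆ Q) (e : P.Edge) :
    lower (P.revealed w S) e ≤ lower (P.revealed w Q) e := by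
  by_cases h : e ∈ Q
  · rw [lower_of_mem h]
    exact hw.lower_le S e
  · exact (lower_eq_of_notMem h hSQ).ge

theorem Realizes.upper_anti (hw : P.Realizes w) (hSQ : S ⊆ Q) (e : P.Edge) :
    upper (P.revealed w Q) e ≤ upper (P.revealed w S) e := by
  by_cases h : e ∈ Q
  · rw [upper_of_mem h]
    exact hw.le_upper S e
  · exact (upper_eq_of_notMem h hSQ).le

theorem Realizes.alwaysMaximal_mono (hw : P.Realizes w) (hSQ : S ⊆ Q)
    (h : AlwaysMaximal (P.revealed w S) C g) : AlwaysMaximal (P.revealed w Q) C g :=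
  ⟨h.1, fun e he hne =>
    (hw.upper_anti hSQ e).trans ((h.2 e he hne).trans (hw.lower_mono hSQ g))⟩

/-- An unqueried edge with largest upper limit in a cycle without an edge that has both the largest
lower and the largest upper limit belongs to every feasible query set. -/
theorem Realizes.mem_of_largest_upper (hw : P.Realizes w) (hSQ : S ⊆ Q) (hfC : f ∈ C)
    (hU : ∀ e ∈ C, upper (P.revealed w S) e ≤ upper (P.revealed w S) f)
    (hno : ¬ ∃ h ∈ C, (∀ e ∈ C, lower (P.revealed w S) e ≤ lower (P.revealed w S) h) ∧
      ∀ e ∈ C, upper (P.revealed w S) e ≤ upper (P.revealed w S) h)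
    (hg : AlwaysMaximal (P.revealed w Q) C g) : f ∈ Q := by
  by_contra hf
  apply hno
  by_cases hgf : g = f
  · subst hgf
    refine ⟨g, hfC, fun e he => ?_, hU⟩
    by_cases heg : e = g
    · rw [heg]
    · calc lower (P.revealed w S) e ≤ lower (P.revealed w Q) e := hw.lower_mono hSQ e
        _ ≤ upper (P.revealed w Q) e := hw.lower_le_upper Q e
        _ ≤ lower (P.revealed w Q) g := hg.2 e he heg
        _ = lower (P.revealed w S) g := lower_eq_of_notMem hf hSQ
  · have h1 : upper (P.revealed w S) f ≤ lower (P.revealed w Q) g := by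
      rw [← upper_eq_of_notMem hf hSQ]
      exact hg.2 f hfC fun h => hgf h.symm
    have h2 := hU g hg.1
    -- If `g` was queried, its weight is at least `U_f ≥ U_g`. An attained upper limit means a
    -- trivial set, so the query did not raise the lower limit of `g`.
    have h3 : upper (P.revealed w S) f ≤ lower (P.revealed w S) g := by
      by_cases hgQ : g ∈ Q
      · rw [lower_of_mem hgQ] at h1
        rw [hw.lower_eq_of_upper_le (h2.trans h1)]
        exact h1
      · rwa [← lower_eq_of_notMem hgQ hSQ]
    refine ⟨g, hg.1, fun e he => ?_, fun e he => ?_⟩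
    · exact (hw.lower_le_upper S e).trans ((hU e he).trans h3)
    · exact (hU e he).trans (h3.trans (hw.lower_le_upper S g))

/-- A witness pair: one of the edges belongs to every feasible query set. -/
theorem Realizes.mem_or_mem (hw : P.Realizes w) (hSQ : S ⊆ Q) (hfC : f ∈ C)
    (hL : ∀ e ∈ C, lower (P.revealed w S) e ≤ lower (P.revealed w S) f)
    (hU : ∀ e ∈ C, upper (P.revealed w S) e ≤ upper (P.revealed w S) f)
    (he : e ∈ neighbors (P.revealed w S) C f)
    (hg : AlwaysMaximal (P.revealed w Q) C g) (hf : f ∉ Q) : e ∈ Q := by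
  obtain ⟨heC, hef, hlt⟩ := he
  by_contra heQ
  have hltf := hlt.trans_le (hU e heC)
  by_cases hgf : g = f
  · subst hgf
    have h := hg.2 e heC hef
    rw [upper_eq_of_notMem heQ hSQ, lower_eq_of_notMem hf hSQ] at h
    exact absurd hlt (not_lt.2 h)
  -- An always maximal `g ≠ f` would have, already with the information `S`, a lower limit of at
  -- least `U_f > L_f`, against `hL`.
  · have h1 : upper (P.revealed w S) f ≤ lower (P.revealed w Q) g := by
      rw [← upper_eq_of_notMem hf hSQ]
      exact hg.2 f hfC fun h => hgf h.symm
    have h2 := hU g hg.1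
    have h3 : upper (P.revealed w S) f ≤ lower (P.revealed w S) g := by
      by_cases hgQ : g ∈ Q
      · rw [lower_of_mem hgQ] at h1
        rw [hw.lower_eq_of_upper_le (h2.trans h1)]
        exact h1
      · rwa [← lower_eq_of_notMem hgQ hSQ]
    exact absurd hltf (not_lt.2 (h3.trans (hL g hg.1)))

/-- If some feasible query set does not contain `f`, the query of the neighbors of `f` suffices. -/
theorem Realizes.exists_alwaysMaximal_of_notMem (hw : P.Realizes w) (hSQ : S ⊆ Q) (hfC : f ∈ C)
    (hL : ∀ e ∈ C, lower (P.revealed w S) e ≤ lower (P.revealed w S) f)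
    (hU : ∀ e ∈ C, upper (P.revealed w S) e ≤ upper (P.revealed w S) f)
    (hlt : lower (P.revealed w S) f < upper (P.revealed w S) f)
    (hg : AlwaysMaximal (P.revealed w Q) C g) (hf : f ∉ Q) {S' : Finset P.Edge} (hS : S ⊆ S')
    (hX : ∀ e ∈ neighbors (P.revealed w S) C f, e ∈ S') :
    ∃ h, AlwaysMaximal (P.revealed w S') C h := by
  have hXQ : ∀ e ∈ neighbors (P.revealed w S) C f, e ∈ Q := fun e he =>
    hw.mem_or_mem hSQ hfC hL hU he hg hf
  have hother : ∀ e ∈ C, e ≠ f → e ∉ neighbors (P.revealed w S) C f →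
      upper (P.revealed w S) e ≤ lower (P.revealed w S) f := by
    intro e he hne hX
    by_contra! h
    exact hX ⟨he, hne, h⟩
  by_cases hgf : g = f
  · subst hgf
    refine ⟨g, hfC, fun e he hne => ?_⟩
    refine le_trans ?_ (hw.lower_mono hS g)
    by_cases heX : e ∈ neighbors (P.revealed w S) C g
    · have h := hg.2 e he hne
      rw [upper_of_mem (hXQ e heX), lower_eq_of_notMem hf hSQ] at h
      rwa [upper_of_mem (hX e heX)]
    · exact (hw.upper_anti hS e).trans (hother e he hne heX)
  -- Now `U_g ≥ U_f > L_f`, so `g` is a neighbor of `f`, and its revealed weight is at least every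
  -- upper limit on the cycle.
  · have h1 : upper (P.revealed w S) f ≤ lower (P.revealed w Q) g := by
      rw [← upper_eq_of_notMem hf hSQ]
      exact hg.2 f hfC fun h => hgf h.symm
    have h1' : upper (P.revealed w S) f ≤ upper (P.revealed w S) g :=
      h1.trans ((hw.lower_le_upper Q g).trans (hw.upper_anti hSQ g))
    have hgX : g ∈ neighbors (P.revealed w S) C f := ⟨hg.1, hgf, hlt.trans_le h1'⟩
    refine ⟨g, hg.1, fun e he hne => ?_⟩
    rw [lower_of_mem (hX g hgX)]
    rw [lower_of_mem (hXQ g hgX)] at h1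
    exact (hw.upper_anti hS e).trans ((hU e he).trans h1)

/-- After the query of `f` and as long as no edge of the cycle is always maximal, the unqueried
edges with largest upper limit are neighbors of `f` and belong to every feasible query set. -/
theorem Realizes.mem_of_largest_unqueried (hw : P.Realizes w) {S' : Finset P.Edge} (hS : S ⊆ S')
    (hfC : f ∈ C) (hL : ∀ e ∈ C, lower (P.revealed w S) e ≤ lower (P.revealed w S) f)
    (hlt : lower (P.revealed w S) f < upper (P.revealed w S) f)
    (hf : f ∈ S') (hno : ¬ ∃ h, AlwaysMaximal (P.revealed w S') C h)
    (heC : e ∈ C) (heS : e ∉ S')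
    (hmax : ∀ e' ∈ C, e' ∉ S' → upper (P.revealed w S') e' ≤ upper (P.revealed w S') e) :
    e ∈ neighbors (P.revealed w S) C f ∧
      ∀ Q, S' ⊆ Q → (∃ g, AlwaysMaximal (P.revealed w Q) C g) → e ∈ Q := by
  have hwf := (hw.strict hlt).2.1
  -- Otherwise the heaviest queried edge of `C` would reach the upper limit of `e`, hence all
  -- unqueried upper limits, and be always maximal.
  have hqueried : ∀ m ∈ C, m ∈ S' → (w m : EReal) < upper (P.revealed w S') e := by
    intro m hmC hmS
    have hfin : {e ∈ (S' : Set P.Edge) | e ∈ C}.Finite := S'.finite_toSet.subset fun _ h => h.1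
    obtain ⟨k, ⟨hkS, hkC⟩, hk⟩ := Set.exists_max_image _ w hfin ⟨m, hmS, hmC⟩
    refine lt_of_le_of_lt (EReal.coe_le_coe_iff.2 (hk m ⟨hmS, hmC⟩)) ?_
    by_contra! h
    refine hno ⟨k, hkC, fun e' he' hne => ?_⟩
    rw [lower_of_mem hkS]
    by_cases he'S : e' ∈ S'
    · rw [upper_of_mem he'S]
      exact EReal.coe_le_coe_iff.2 (hk e' ⟨he'S, he'⟩)
    · exact (hmax e' he' he'S).trans h
  have hfe := hqueried f hfC hf
  refine ⟨⟨heC, fun h => heS (h ▸ hf), ?_⟩, ?_⟩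
  · exact hwf.trans (hfe.trans_le (hw.upper_anti hS e))
  · rintro Q hSQ ⟨g, hg⟩
    by_contra heQ
    have hfQ : (w f : EReal) ≤ upper (P.revealed w Q) f := hw.le_upper Q f
    -- If `e ∉ Q`, neither `e` nor another `g ∉ S'` can be always maximal, since its lower limit
    -- with respect to `S` would be at least `w f`. Edges of `S'` are excluded by `hqueried`.
    have hlow : ∀ h ∈ C, lower (P.revealed w S) h < w f := fun h hh => (hL h hh).trans_lt hwf
    have hef : f ≠ e := fun h => heS (h ▸ hf)
    by_cases hge : g = e
    · subst hge
      have h1 := hg.2 f hfC hef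
      rw [lower_eq_of_notMem heQ (hS.trans hSQ)] at h1
      exact absurd (hlow g heC) (not_lt.2 (hfQ.trans h1))
    · have h1 : upper (P.revealed w S') e ≤ lower (P.revealed w Q) g := by
        rw [← upper_eq_of_notMem heQ hSQ]
        exact hg.2 e heC fun h => hge h.symm
      by_cases hgS : g ∈ S'
      · rw [lower_of_mem (hSQ hgS)] at h1
        exact absurd (hqueried g hg.1 hgS) (not_lt.2 h1)
      · have h3 : upper (P.revealed w S') e ≤ lower (P.revealed w S') g := by
          by_cases hgQ : g ∈ Q
          · rw [lower_of_mem hgQ] at h1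
            rw [hw.lower_eq_of_upper_le ((hmax g hg.1 hgS).trans h1)]
            exact h1
          · rwa [← lower_eq_of_notMem hgQ hSQ]
        rw [lower_eq_of_notMem hgS hS] at h3
        exact absurd (hlow g hg.1) (not_lt.2 (hfe.le.trans h3))

/-- After the query of the neighbors of `f`, the edge `f` is the unqueried edge of the cycle with
largest upper limit. -/
theorem eq_of_largest_unqueried {S' : Finset P.Edge} (hS : S ⊆ S')
    (hX : ∀ e ∈ neighbors (P.revealed w S) C f, e ∈ S') (hfC : f ∈ C)
    (hlt : lower (P.revealed w S) f < upper (P.revealed w S) f) (hf : f ∉ S')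
    (heC : e ∈ C) (heS : e ∉ S')
    (hmax : ∀ e' ∈ C, e' ∉ S' → upper (P.revealed w S') e' ≤ upper (P.revealed w S') e) :
    e = f := by
  by_contra hne
  have h := hmax f hfC hf
  rw [upper_eq_of_notMem hf hS, upper_eq_of_notMem heS hS] at h
  exact heS (hX e ⟨heC, hne, hlt.trans_le h⟩)

theorem exists_alwaysMaximal_of_subset (hne : C.Nonempty) (h : ∀ e ∈ C, e ∈ S) :
    ∃ g, AlwaysMaximal (P.revealed w S) C g := by
  obtain ⟨k, hk, hmax⟩ := Set.exists_max_image C w (S.finite_toSet.subset h) hne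
  refine ⟨k, hk, fun e he _ => ?_⟩
  rw [upper_of_mem (h e he), lower_of_mem (h k hk)]
  exact EReal.coe_le_coe_iff.2 (hmax e he)

/-- A query set for a cactus is feasible if every cycle has an always maximal edge. -/
theorem feasible_iff [Finite V] (hG : IsCactus P.graph) (hw : P.Realizes w) :
    P.Feasible w Q ↔ ∀ C, IsCycleSet P.graph C → ∃ g, AlwaysMaximal (P.revealed w Q) C g := by
  constructor
  · rintro ⟨T, hT, h⟩ C hC
    obtain ⟨g, hgC, hg, -⟩ := ((hG.isSpanningTree_iff T).1 hT).1 C hC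
    refine ⟨g, hgC, fun e he hne => ?_⟩
    refine sSup_le ?_
    rintro _ ⟨x, hx, rfl⟩
    refine le_sInf ?_
    rintro _ ⟨y, hy, rfl⟩
    rw [EReal.coe_le_coe_iff]
    -- Arbitrary values `x` and `y` for `e` and `g` occur together in one possible weight function,
    -- and the tree omitting `g` is minimum for it; hence `x ≤ y`.
    have hmem : ∀ h, Function.update (Function.update w e x) g y h ∈ P.revealed w Q h := by
      intro h
      by_cases h1 : h = g
      · subst h1
        simpa using hy
      · by_cases h2 : h = e
        · subst h2
          simpa [h1] using hx
        · simpa [h1, h2] using hw.mem_revealed Q h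
    have hmst := h (Function.update (Function.update w e x) g y)
      (fun h hh => by simpa [revealed, hh] using hmem h)
      (fun h hh => by simpa only [revealed, hh, if_false] using hmem h)
    simpa [hne] using ((hG.isMST_iff _ T).1 hmst).2 C hC g hgC hg e he
  · intro h
    choose p hp using h
    obtain ⟨T, hT, hTp⟩ := hG.exists_isSpanningTree p fun C hC => (hp C hC).1
    refine ⟨T, hT, fun w' h1 h2 => (hG.isMST_iff w' T).2 ⟨hT, fun C hC f hfC hf e heC => ?_⟩⟩
    have hmem : ∀ e, w' e ∈ P.revealed w Q e := by
      intro e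
      by_cases he : e ∈ Q
      · simpa [revealed, he] using h1 e he
      · simpa only [revealed, he, if_false] using h2 e he
    rw [hTp C hC f hfC hf]
    by_cases hep : e = p C hC
    · rw [hep]
    · rw [← EReal.coe_le_coe_iff]
      have h3 : (w' e : EReal) ≤ upper (P.revealed w Q) e := le_sSup ⟨_, hmem e, rfl⟩
      have h4 : lower (P.revealed w Q) (p C hC) ≤ w' (p C hC) := sInf_le ⟨_, hmem _, rfl⟩
      exact h3.trans (((hp C hC).2 e heC hep).trans h4)

theorem Feasible.mono [Finite V] (hG : IsCactus P.graph) (hw : P.Realizes w)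
    (h : P.Feasible w S) (hSQ : S ⊆ Q) : P.Feasible w Q := by
  rw [feasible_iff hG hw] at h ⊢
  intro C hC
  obtain ⟨g, hg⟩ := h C hC
  exact ⟨g, hw.alwaysMaximal_mono hSQ hg⟩

end Limits

end UncertaintyGraph

/-! ### Programs, the preprocessing and the while-loop. -/

namespace Program

variable {E : Type u} {α β : Type v}

theorem result_bind (w : E → ℝ) (p : Program E α) (g : α → Program E β) :
    (p.bind g).result w = (g (p.result w)).result w := by
  induction p with
  | done a => rfl
  | query e next ih => exact ih (w e)

/-- `queries` is built with the classical decidability instance; allowing any instance for the union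
lets the lemma apply to concrete edge types. -/
theorem queries_bind [DecidableEq E] (w : E → ℝ) (p : Program E α) (g : α → Program E β) :
    (p.bind g).queries w = p.queries w ∪ (g (p.result w)).queries w := by
  induction p with
  | done a => simp [bind, queries, result]
  | query e next ih =>
    have h := ih (w e)
    ext x
    have h' := Finset.ext_iff.1 h x
    simp only [bind, queries, result, Finset.mem_union, Finset.mem_insert] at h' ⊢
    rw [h', or_assoc]

end Program

/-- Every cycle loses exactly one edge in either tree, so neither tree can be strictly larger. -/
theorem IsCactus.eq_of_subset {V : Type u} {G : SimpleGraph V} (hG : IsCactus G)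
    {T T' : Finset G.edgeSet} (hT : IsSpanningTree G T) (hT' : IsSpanningTree G T')
    (h : T ⊆ T') : T = T' := by
  refine Finset.Subset.antisymm h fun e he => ?_
  by_contra heT
  obtain ⟨C, hC, heC⟩ := ((hG.isSpanningTree_iff T).1 hT).2 e heT
  obtain ⟨f, hfC, hf, -⟩ := ((hG.isSpanningTree_iff T').1 hT').1 C hC
  exact hf (hG.eq_of_notMem hT hC heC heT hfC (fun h' => hf (h h')) ▸ he)

namespace UncertaintyGraph

variable {V : Type u} {P : UncertaintyGraph V} {w : P.Edge → ℝ} {S Q : Finset P.Edge}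

theorem cost_mono (h : S ⊆ Q) : P.cost S ≤ P.cost Q :=
  Finset.sum_le_sum_of_subset_of_nonneg h fun e _ _ => (P.queryCost_pos e).le

theorem cost_nonneg (S : Finset P.Edge) : 0 ≤ P.cost S :=
  Finset.sum_nonneg fun e _ => (P.queryCost_pos e).le

theorem cost_union_le (S Q : Finset P.Edge) : P.cost (S ∪ Q) ≤ P.cost S + P.cost Q := by
  have h := Finset.sum_union_inter (s₁ := S) (s₂ := Q) (f := P.queryCost)
  have h' := P.cost_nonneg (S ∩ Q)
  simp only [cost] at h' ⊢
  linarith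

theorem cost_insert_le (e : P.Edge) (S : Finset P.Edge) :
    P.cost (insert e S) ≤ P.queryCost e + P.cost S := by
  rw [Finset.insert_eq]
  simpa [cost] using cost_union_le {e} S

theorem queryAll_spec (l : List P.Edge) (S : Finset P.Edge) :
    (queryAll l (P.known w S)).result w = P.known w (S ∪ l.toFinset) ∧
      (queryAll l (P.known w S)).queries w = l.toFinset := by
  induction l generalizing S with
  | nil => simp [queryAll, Program.result, Program.queries]
  | cons e l ih =>
    have h := ih (insert e S)
    simp only [queryAll, Program.result, Program.queries, reveal_known, List.toFinset_cons]
    rw [h.1, h.2]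
    refine ⟨?_, ?_⟩
    · rw [Finset.union_insert, Finset.insert_union]
    · ext x
      simp

namespace ChoiceRule

variable (R : P.ChoiceRule)

theorem isSpanningTree_lowerTree (hG : IsCactus P.graph) (K : P.Knowledge) :
    IsSpanningTree P.graph (R.lowerTree K) :=
  ((hG.isLimitMST_iff _ _).1 (R.lowerTree_spec K)).1

theorem isSpanningTree_upperTree (hG : IsCactus P.graph) (K : P.Knowledge) :
    IsSpanningTree P.graph (R.upperTree K) :=
  ((hG.isLimitMST_iff _ _).1 (R.upperTree_spec K)).1

theorem lower_le (hG : IsCactus P.graph) (K : P.Knowledge) {C : Set P.Edge}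
    (hC : IsCycleSet P.graph C) {e f : P.Edge} (hfC : f ∈ C) (hf : f ∉ R.lowerTree K)
    (he : e ∈ C) : lower K.sets e ≤ lower K.sets f :=
  ((hG.isLimitMST_iff _ _).1 (R.lowerTree_spec K)).2 C hC f hfC hf e he

theorem upper_le (hG : IsCactus P.graph) (K : P.Knowledge) {C : Set P.Edge}
    (hC : IsCycleSet P.graph C) {e f : P.Edge} (hfC : f ∈ C) (hf : f ∉ R.upperTree K)
    (he : e ∈ C) : upper K.sets e ≤ upper K.sets f :=
  ((hG.isLimitMST_iff _ _).1 (R.upperTree_spec K)).2 C hC f hfC hf e he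

/-- If the limit trees differ on a cycle, then no edge of it has both limits largest. -/
theorem not_exists_common_max (hG : IsCactus P.graph) (K : P.Knowledge) {C : Set P.Edge}
    (hC : IsCycleSet P.graph C) {f : P.Edge} (hfC : f ∈ C)
    (hf : f ∈ R.lowerTree K \ R.upperTree K) :
    ¬ ∃ h ∈ C, (∀ e ∈ C, lower K.sets e ≤ lower K.sets h) ∧
      ∀ e ∈ C, upper K.sets e ≤ upper K.sets h := by
  rintro ⟨h, hhC, hL, hU⟩
  have hTL := R.isSpanningTree_lowerTree hG K
  have hTU := R.isSpanningTree_upperTree hG K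
  obtain ⟨g, hgC, hg, -⟩ := ((hG.isSpanningTree_iff _).1 hTL).1 C hC
  rw [Finset.mem_sdiff] at hf
  -- An edge `h` with the largest limit may take over the role of the omitted edge of `C` without
  -- loss of minimality.
  have aux : ∀ (l : P.Edge → EReal) (T : Finset P.Edge) (f : P.Edge), IsLimitMST P.graph l T →
      f ∈ C → f ∉ T → (∀ e ∈ C, l e ≤ l h) →
      IsLimitMST P.graph l ((insert f T).erase h) := by
    intro l T f hT hfC hf hl
    rw [hG.isLimitMST_iff] at hT ⊢
    have hT' := hG.exchange hT.1 hC hfC hf hhC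
    refine ⟨hT', fun D hD e heD he e' he' => ?_⟩
    by_cases hDC : D = C
    · subst hDC
      rw [hG.eq_of_notMem hT' hC heD he hhC (Finset.notMem_erase h _)]
      exact hl e' he'
    · refine hT.2 D hD e heD (fun heT => he ?_) e' he'
      rw [Finset.mem_erase, Finset.mem_insert]
      exact ⟨fun heq => hDC (hG.eq_of_mem hD hC heD (heq ▸ hhC)), Or.inr heT⟩
  have h1 := aux _ _ g (R.lowerTree_spec K) hgC hg hL
  have h2 := aux _ _ f (R.upperTree_spec K) hfC hf.2 hU
  -- Letting both trees omit `h` on `C` removes `f` from their difference and adds nothing, against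
  -- the minimal choice of the trees.
  refine absurd (R.agree K _ _ h1 h2) (not_le.2 (Finset.card_lt_card ?_))
  refine (Finset.ssubset_iff_of_subset ?_).2 ⟨f, Finset.mem_sdiff.2 hf, ?_⟩
  · intro x hx
    simp only [Finset.mem_sdiff, Finset.mem_erase, Finset.mem_insert, not_and, not_or] at hx ⊢
    obtain ⟨⟨hxh, hx1⟩, hx2⟩ := hx
    have hxU := (hx2 hxh).2
    refine ⟨hx1.resolve_left ?_, hxU⟩
    rintro rfl
    exact (hx2 hxh).1 (hG.eq_of_notMem hTU hC hgC hxU hfC hf.2)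
  · simp only [Finset.mem_sdiff, Finset.mem_erase, Finset.mem_insert, not_and, not_or]
    rintro ⟨hfh, -⟩
    exact fun hcon => (hcon hfh).1 trivial

variable [Finite V]

/-- An edge outside the upper limit tree has the largest upper limit on its cycle, and the minimal
choice of the trees rules out an edge with both limits largest; so the query is new and forced. -/
theorem sdiff_spec (hG : IsCactus P.graph) (hw : P.Realizes w) {f : P.Edge}
    (hf : f ∈ R.lowerTree (P.known w S) \ R.upperTree (P.known w S)) :
    f ∉ S ∧ ∀ Q, S ⊆ Q → P.Feasible w Q → f ∈ Q := by
  have hf' := (Finset.mem_sdiff.1 hf).2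
  obtain ⟨C, hC, hfC⟩ := ((hG.isSpanningTree_iff _).1
    (R.isSpanningTree_upperTree hG (P.known w S))).2 f hf'
  have hno := R.not_exists_common_max hG _ hC hfC hf
  have hU : ∀ e ∈ C, upper (P.revealed w S) e ≤ upper (P.revealed w S) f :=
    fun e he => R.upper_le hG (P.known w S) hC hfC hf' he
  refine ⟨fun hfS => hno ⟨f, hfC, fun e he => ?_, hU⟩, fun Q hSQ hQ => ?_⟩
  · have h := (hw.lower_le_upper S e).trans (hU e he)
    rw [upper_of_mem hfS, ← lower_of_mem hfS] at h
    exact h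
  · obtain ⟨g, hg⟩ := (feasible_iff hG hw).1 hQ C hC
    exact hw.mem_of_largest_upper hSQ hfC hU hno hg

/-- The inequality `hn` says that the round counter is sufficient: every round queries a new edge,
and at counter 0 all edges are queried, so that by `sdiff_spec` the trees agree. -/
theorem preprocessAux_spec (hG : IsCactus P.graph) (hw : P.Realizes w) (n : ℕ)
    (S : Finset P.Edge) (hn : Nat.card P.Edge ≤ n + S.card) :
    (R.preprocessAux n (P.known w S)).result w =
        P.known w (S ∪ (R.preprocessAux n (P.known w S)).queries w) ∧
      R.lowerTree ((R.preprocessAux n (P.known w S)).result w) =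
        R.upperTree ((R.preprocessAux n (P.known w S)).result w) ∧
      ∀ Q, S ⊆ Q → P.Feasible w Q → (R.preprocessAux n (P.known w S)).queries w ⊆ Q := by
  have := Fintype.ofFinite P.Edge
  induction n generalizing S with
  | zero =>
    simp only [preprocessAux, Program.result, Program.queries]
    refine ⟨by simp, ?_, by simp⟩
    refine hG.eq_of_subset (R.isSpanningTree_lowerTree hG _) (R.isSpanningTree_upperTree hG _) ?_
    intro e he
    by_contra he'
    refine (R.sdiff_spec hG hw (Finset.mem_sdiff.2 ⟨he, he'⟩)).1 ?_
    rw [Nat.card_eq_fintype_card, zero_add] at hn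
    rw [Finset.eq_univ_of_card S (le_antisymm (Finset.card_le_univ S) hn)]
    exact Finset.mem_univ e
  | succ n ih =>
    by_cases heq : R.lowerTree (P.known w S) = R.upperTree (P.known w S)
    · simp only [preprocessAux, heq, if_true, Program.result, Program.queries]
      simp
    · set D := R.lowerTree (P.known w S) \ R.upperTree (P.known w S) with hD
      have hne : D.Nonempty := by
        rw [hD, Finset.sdiff_nonempty]
        exact fun hsub => heq (hG.eq_of_subset (R.isSpanningTree_lowerTree hG _)
          (R.isSpanningTree_upperTree hG _) hsub)
      have hdis : Disjoint S D := Finset.disjoint_right.2 fun e he => (R.sdiff_spec hG hw he).1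
      have hcard : Nat.card P.Edge ≤ n + (S ∪ D).card := by
        rw [Finset.card_union_of_disjoint hdis]
        have := hne.card_pos
        omega
      have hq := queryAll_spec (P := P) (w := w) D.toList S
      rw [Finset.toList_toFinset] at hq
      obtain ⟨h1, h2, h3⟩ := ih (S ∪ D) hcard
      simp only [preprocessAux, heq, if_false, ← hD, Program.result_bind, Program.queries_bind,
        hq.1, hq.2]
      refine ⟨by rw [h1, Finset.union_assoc], h2, fun Q hSQ hQ => ?_⟩
      have hDQ : D ⊆ Q := fun e he => (R.sdiff_spec hG hw he).2 Q hSQ hQ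
      exact Finset.union_subset hDQ (h3 Q (Finset.union_subset hSQ hDQ) hQ)

/-- `Y` is a set that provably contains every edge the loop may pick, whatever the rule. Different
choices of `Y` turn the same induction into the different cost bounds. -/
theorem finishAux_spec (C : Set P.Edge) (hC : C.Nonempty) (Y : Finset P.Edge) (n : ℕ)
    (S : Finset P.Edge) (hn : Nat.card P.Edge ≤ n + S.card)
    (hY : ∀ S' : Finset P.Edge, S ⊆ S' → S' ⊆ S ∪ Y →
      (¬ ∃ h, AlwaysMaximal (P.revealed w S') C h) → ∀ g ∈ C, g ∉ S' →
      (∀ e ∈ C, e ∉ S' → upper (P.revealed w S') e ≤ upper (P.revealed w S') g) → g ∈ Y) :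
    (R.finishAux C n (P.known w S)).result w =
        P.known w (S ∪ (R.finishAux C n (P.known w S)).queries w) ∧
      (R.finishAux C n (P.known w S)).queries w ⊆ Y ∧
      ∃ h, AlwaysMaximal (P.revealed w (S ∪ (R.finishAux C n (P.known w S)).queries w)) C h := by
  have := Fintype.ofFinite P.Edge
  induction n generalizing S with
  | zero =>
    simp only [finishAux, Program.result, Program.queries, Finset.union_empty]
    refine ⟨trivial, by simp, exists_alwaysMaximal_of_subset hC fun e _ => ?_⟩
    rw [Nat.card_eq_fintype_card, zero_add] at hn
    rw [Finset.eq_univ_of_card S (le_antisymm (Finset.card_le_univ S) hn)]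
    exact Finset.mem_univ e
  | succ n ih =>
    by_cases hmax : ∃ h, AlwaysMaximal (P.revealed w S) C h
    · have hmax' : ∃ h, AlwaysMaximal (P.known w S).sets C h := hmax
      simp only [finishAux, hmax', if_true, Program.result, Program.queries, Finset.union_empty]
      exact ⟨trivial, by simp, hmax⟩
    · have hmax' : ¬ ∃ h, AlwaysMaximal (P.known w S).sets C h := hmax
      have hun : ∃ e ∈ C, e ∉ (P.known w S).queried := by
        by_contra! h
        exact hmax (exists_alwaysMaximal_of_subset hC h)
      obtain ⟨g, hg, hgC, hgS, hgmax⟩ := R.pick_spec (P.known w S) C hun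
      have hgS : g ∉ S := hgS
      have hgY : g ∈ Y := hY S (Finset.Subset.refl S) Finset.subset_union_left hmax g hgC hgS hgmax
      have hcard : Nat.card P.Edge ≤ n + (insert g S).card := by
        rw [Finset.card_insert_of_notMem hgS]
        omega
      obtain ⟨h1, h2, h3⟩ := ih (insert g S) hcard (fun S' hS' hS'Y => hY S'
        ((Finset.subset_insert g S).trans hS') (hS'Y.trans (by
          rw [Finset.insert_union]
          exact Finset.insert_subset (Finset.mem_union_right _ hgY) (Finset.Subset.refl _))))
      simp only [finishAux, hmax', if_false, hg, Program.result, Program.queries, reveal_known]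
      have hunion : ∀ A : Finset P.Edge, insert g S ∪ A = S ∪ insert g A := by
        intro A
        rw [Finset.union_insert, Finset.insert_union]
      rw [hunion] at h1 h3
      refine ⟨?_, ?_, ?_⟩
      -- The two sides differ only in the decidability instance inside `insert`.
      · convert h1
      · intro x hx
        simp only [Finset.mem_insert] at hx
        rcases hx with rfl | hx
        · exact hgY
        · exact h2 hx
      · convert h3

end ChoiceRule

end UncertaintyGraph

/-! ### Treatment of the cycles and correctness of the algorithm. -/

namespace UncertaintyGraph

variable {V : Type u} {P : UncertaintyGraph V} {w : P.Edge → ℝ} {S Q : Finset P.Edge}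

/-- The threshold for the random number, if the edge `f` has the neighbors `X`. -/
noncomputable def threshold (P : UncertaintyGraph V) (f : P.Edge) (X : Finset P.Edge) : ℝ :=
  P.queryCost f ^ 2 / (P.queryCost f ^ 2 + P.cost X ^ 2)

/-- A bound for the query cost on the cycle closed by `f`, in comparison with the query set `Q`. -/
noncomputable def treatBound (P : UncertaintyGraph V) (b : ℝ) (f : P.Edge) (X Q : Finset P.Edge) :
    ℝ :=
  if X = ∅ then 0
  else if b ≤ P.threshold f X then (if f ∈ Q then P.cost X + P.queryCost f else P.cost X)
  else P.queryCost f + (if f ∈ Q then P.cost (X ∩ Q) else P.cost X)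

/-- If the neighborhood of `f` is not empty, then `f` and its neighbors are nontrivial. -/
theorem Realizes.notMem_of_neighbors (hw : P.Realizes w) {C : Set P.Edge} {e f : P.Edge}
    (hL : ∀ e ∈ C, lower (P.revealed w S) e ≤ lower (P.revealed w S) f)
    (hU : ∀ e ∈ C, upper (P.revealed w S) e ≤ upper (P.revealed w S) f)
    (he : e ∈ neighbors (P.revealed w S) C f) :
    lower (P.revealed w S) f < upper (P.revealed w S) f ∧ f ∉ S ∧ e ∉ S := by
  have h1 := he.2.2.trans_le (hU e he.1)
  exact ⟨h1, (hw.strict h1).1, (hw.strict ((hL e he.1).trans_lt he.2.2)).1⟩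

theorem alwaysMaximal_of_neighbors_eq_empty {C : Set P.Edge} {f : P.Edge} (hfC : f ∈ C)
    (h : ∀ e, e ∉ neighbors (P.revealed w S) C f) : AlwaysMaximal (P.revealed w S) C f := by
  refine ⟨hfC, fun e he hne => ?_⟩
  by_contra! hlt
  exact h e ⟨he, hne, hlt⟩

variable [Finite V]

theorem mem_X (hG : IsCactus P.graph) {K : P.Knowledge} {T : Finset P.Edge}
    (hT : IsSpanningTree P.graph T) {C : Set P.Edge} (hC : IsCycleSet P.graph C) {f : P.Edge}
    (hfC : f ∈ C) (hf : f ∉ T) {e : P.Edge} : e ∈ K.X T f ↔ e ∈ neighbors K.sets C f := by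
  rw [Knowledge.X, Set.Finite.mem_toFinset, hG.closedCycle_eq hT hC hfC hf]

theorem X_congr (T : Finset P.Edge) (f : P.Edge) (hf : f ∈ closedCycle P.graph T f)
    (h : ∀ e ∈ closedCycle P.graph T f, e ∈ S ↔ e ∈ Q) :
    (P.known w S).X T f = (P.known w Q).X T f := by
  ext e
  simp only [Knowledge.X, Set.Finite.mem_toFinset, neighbors, known, Set.mem_ofPred_eq]
  refine and_congr_right fun he => ?_
  rw [lower_congr (h f hf), upper_congr (h e he)]

namespace ChoiceRule

variable (R : P.ChoiceRule)

/-- Once `X` is queried, only `f` can still be picked (`Y = {f}`). If an always maximal edge can be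
established without `f`, then `X` already establishes one, and the loop stops at once (`Y = ∅`). -/
theorem finish_after_neighbors (hw : P.Realizes w) {C : Set P.Edge} {f : P.Edge} (hfC : f ∈ C)
    (hL : ∀ e ∈ C, lower (P.revealed w S) e ≤ lower (P.revealed w S) f)
    (hU : ∀ e ∈ C, upper (P.revealed w S) e ≤ upper (P.revealed w S) f)
    (hlt : lower (P.revealed w S) f < upper (P.revealed w S) f)
    {X : Finset P.Edge} (hX : ∀ e, e ∈ X ↔ e ∈ neighbors (P.revealed w S) C f) :
    (R.finish C (P.known w (S ∪ X))).result w =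
        P.known w (S ∪ X ∪ (R.finish C (P.known w (S ∪ X))).queries w) ∧
      (∃ h, AlwaysMaximal
        (P.revealed w (S ∪ X ∪ (R.finish C (P.known w (S ∪ X))).queries w)) C h) ∧
      (R.finish C (P.known w (S ∪ X))).queries w ⊆ {f} ∧
      ∀ Q, S ⊆ Q → (∃ g, AlwaysMaximal (P.revealed w Q) C g) → f ∉ Q →
        (R.finish C (P.known w (S ∪ X))).queries w = ∅ := by
  have hXS : ∀ S', S ∪ X ⊆ S' → ∀ e ∈ neighbors (P.revealed w S) C f, e ∈ S' := fun S' h e he =>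
    h (Finset.mem_union_right _ ((hX e).2 he))
  have key := fun Y hY => R.finishAux_spec (w := w) C ⟨f, hfC⟩ Y (Nat.card P.Edge) (S ∪ X)
    (Nat.le_add_right _ _) hY
  have h1 := key {f} (by
    intro S' hS' _ hno g hgC hgS hmax
    rw [Finset.mem_singleton]
    have hSS' : S ⊆ S' := Finset.subset_union_left.trans hS'
    by_cases hf : f ∈ S'
    · exact absurd (hXS S' hS' g
        (hw.mem_of_largest_unqueried hSS' hfC hL hlt hf hno hgC hgS hmax).1) hgS
    · exact eq_of_largest_unqueried hSS' (hXS S' hS') hfC hlt hf hgC hgS hmax)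
  refine ⟨h1.1, h1.2.2, h1.2.1, ?_⟩
  rintro Q hSQ ⟨g, hg⟩ hf
  have h2 := key ∅ (by
    intro S' hS' _ hno
    exact absurd (hw.exists_alwaysMaximal_of_notMem hSQ hfC hL hU hlt hg hf
      (Finset.subset_union_left.trans hS') (hXS S' hS')) hno)
  exact Finset.subset_empty.1 h2.2.1

/-- After `f` only neighbors are picked (`Y = X`). If `f ∈ Q`, the queried set stays inside `Q`, so
each pick is forced to lie in `Q` as well (`Y = X ∩ Q`). -/
theorem finish_after_edge (hw : P.Realizes w) {C : Set P.Edge} {f : P.Edge} (hfC : f ∈ C)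
    (hL : ∀ e ∈ C, lower (P.revealed w S) e ≤ lower (P.revealed w S) f)
    (hlt : lower (P.revealed w S) f < upper (P.revealed w S) f)
    {X : Finset P.Edge} (hX : ∀ e, e ∈ X ↔ e ∈ neighbors (P.revealed w S) C f) :
    (R.finish C (P.known w (insert f S))).result w =
        P.known w (insert f S ∪ (R.finish C (P.known w (insert f S))).queries w) ∧
      (∃ h, AlwaysMaximal
        (P.revealed w (insert f S ∪ (R.finish C (P.known w (insert f S))).queries w)) C h) ∧
      (R.finish C (P.known w (insert f S))).queries w ⊆ X ∧
      ∀ Q, S ⊆ Q → (∃ g, AlwaysMaximal (P.revealed w Q) C g) → f ∈ Q →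
        (R.finish C (P.known w (insert f S))).queries w ⊆ X ∩ Q := by
  have key := fun Y hY => R.finishAux_spec (w := w) C ⟨f, hfC⟩ Y (Nat.card P.Edge) (insert f S)
    (Nat.le_add_right _ _) hY
  have h1 := key X (by
    intro S' hS' _ hno g hgC hgS hmax
    exact (hX g).2 (hw.mem_of_largest_unqueried ((Finset.subset_insert f S).trans hS') hfC hL hlt
      (hS' (Finset.mem_insert_self f S)) hno hgC hgS hmax).1)
  refine ⟨h1.1, h1.2.2, h1.2.1, ?_⟩
  intro Q hSQ hg hf
  refine (key (X ∩ Q) ?_).2.1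
  intro S' hS' hS'Y hno g hgC hgS hmax
  have h := hw.mem_of_largest_unqueried ((Finset.subset_insert f S).trans hS') hfC hL hlt
    (hS' (Finset.mem_insert_self f S)) hno hgC hgS hmax
  rw [Finset.mem_inter]
  refine ⟨(hX g).2 h.1, h.2 Q (hS'Y.trans ?_) hg⟩
  exact Finset.union_subset (Finset.insert_subset hf hSQ) Finset.inter_subset_right

/-- The treatment of one cycle. -/
theorem treatCycle_spec (hG : IsCactus P.graph) (hw : P.Realizes w) (b : ℝ) {T : Finset P.Edge}
    (hT : IsSpanningTree P.graph T) {C : Set P.Edge} (hC : IsCycleSet P.graph C) {f : P.Edge}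
    (hfC : f ∈ C) (hf : f ∉ T)
    (hL : ∀ e ∈ C, lower (P.revealed w S) e ≤ lower (P.revealed w S) f)
    (hU : ∀ e ∈ C, upper (P.revealed w S) e ≤ upper (P.revealed w S) f) :
    (R.treatCycle b T (P.known w S) f).result w =
        P.known w (S ∪ (R.treatCycle b T (P.known w S) f).queries w) ∧
      (∃ h, AlwaysMaximal
        (P.revealed w (S ∪ (R.treatCycle b T (P.known w S) f).queries w)) C h) ∧
      (∀ e ∈ (R.treatCycle b T (P.known w S) f).queries w, e ∈ C) ∧
      ∀ Q, P.Feasible w Q → P.cost ((R.treatCycle b T (P.known w S) f).queries w) ≤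
        P.treatBound b f ((P.known w S).X T f) Q := by
  have hcl := hG.closedCycle_eq hT hC hfC hf
  have hX : ∀ e, e ∈ (P.known w S).X T f ↔ e ∈ neighbors (P.revealed w S) C f := fun e =>
    mem_X hG hT hC hfC hf
  set X := (P.known w S).X T f with hXdef
  by_cases hXe : X = ∅
  · simp only [treatCycle, ← hXdef, hXe, if_true, Program.result, Program.queries, treatBound]
    refine ⟨by simp, ⟨f, ?_⟩, by simp, by simp [cost]⟩
    rw [Finset.union_empty]
    refine alwaysMaximal_of_neighbors_eq_empty hfC fun e he => ?_
    rw [← hX, hXe] at he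
    exact absurd he (Finset.notMem_empty e)
  · obtain ⟨x, hx⟩ := Finset.nonempty_iff_ne_empty.2 hXe
    obtain ⟨hlt, hfS, -⟩ := hw.notMem_of_neighbors hL hU ((hX x).1 hx)
    have hXS : ∀ e ∈ X, e ∉ S := fun e he => (hw.notMem_of_neighbors hL hU ((hX e).1 he)).2.2
    have hXC : ∀ e ∈ X, e ∈ C := fun e he => ((hX e).1 he).1
    -- `Q` need not contain `S`, so the lemmas are applied to `Q ∪ S`. Neither `f` nor `X` meets
    -- `S`, so this does not change which of these edges are chosen.
    have hfeas : ∀ Q, P.Feasible w Q → ∃ g, AlwaysMaximal (P.revealed w (Q ∪ S)) C g :=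
      fun Q hQ => (feasible_iff hG hw).1 (hQ.mono hG hw Finset.subset_union_left) C hC
    have hfQ : ∀ Q : Finset P.Edge, f ∈ Q ∪ S ↔ f ∈ Q := fun Q => by simp [hfS]
    have hXQ : ∀ Q : Finset P.Edge, X ∩ (Q ∪ S) = X ∩ Q := by
      intro Q
      ext e
      simp only [Finset.mem_inter, Finset.mem_union]
      exact ⟨fun h => ⟨h.1, h.2.resolve_right (hXS e h.1)⟩, fun h => ⟨h.1, Or.inl h.2⟩⟩
    by_cases hb : b ≤ P.threshold f X
    · have hb' : b ≤ P.queryCost f ^ 2 / (P.queryCost f ^ 2 + P.cost X ^ 2) := hb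
      have hq := queryAll_spec (P := P) (w := w) X.toList S
      rw [Finset.toList_toFinset] at hq
      obtain ⟨h1, h2, h3, h4⟩ := R.finish_after_neighbors hw hfC hL hU hlt hX
      simp only [treatCycle, ← hXdef, hXe, if_false, hb', if_true, Program.result_bind,
        Program.queries_bind, hq.1, hq.2, hcl]
      rw [← Finset.union_assoc]
      refine ⟨h1, h2, fun e he => ?_, fun Q hQ => ?_⟩
      · rcases Finset.mem_union.1 he with he | he
        · exact hXC e he
        · rw [Finset.mem_singleton.1 (h3 he)]
          exact hfC
      · simp only [treatBound, hXe, if_false, hb, if_true]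
        split_ifs with hfmem
        · refine (cost_mono (Finset.union_subset_union_right h3)).trans ?_
          refine (cost_union_le _ _).trans ?_
          simp [cost]
        · rw [h4 (Q ∪ S) Finset.subset_union_right (hfeas Q hQ) (by rwa [hfQ]),
            Finset.union_empty]
    · have hb' : ¬ b ≤ P.queryCost f ^ 2 / (P.queryCost f ^ 2 + P.cost X ^ 2) := hb
      obtain ⟨h1, h2, h3, h4⟩ := R.finish_after_edge hw hfC hL hlt hX
      simp only [treatCycle, ← hXdef, hXe, if_false, hb', Program.result,
        Program.queries, hcl, reveal_known]
      have hunion : ∀ A : Finset P.Edge, insert f S ∪ A = S ∪ insert f A := by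
        intro A
        rw [Finset.union_insert, Finset.insert_union]
      rw [hunion] at h1 h2
      refine ⟨by convert h1, by convert h2, fun e he => ?_, fun Q hQ => ?_⟩
      · simp only [Finset.mem_insert] at he
        rcases he with rfl | he
        · exact hfC
        · exact hXC e (h3 he)
      · simp only [treatBound, hXe, if_false, hb]
        have h5 := cost_insert_le f ((R.finish C (P.known w (insert f S))).queries w)
        refine le_trans (le_of_eq ?_) (h5.trans (add_le_add_right ?_ _))
        · congr!
        split_ifs with hfmem
        · refine cost_mono ?_
          rw [← hXQ Q]
          exact h4 (Q ∪ S) Finset.subset_union_right (hfeas Q hQ) (by rwa [hfQ])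
        · exact cost_mono h3

/-- The treatment of several cycles, one after the other. -/
theorem treatCycles_spec (hG : IsCactus P.graph) (hw : P.Realizes w) (b : ℝ) {T : Finset P.Edge}
    (hT : IsSpanningTree P.graph T) (S₀ : Finset P.Edge)
    (hL : ∀ C, IsCycleSet P.graph C → ∀ f ∈ C, f ∉ T → ∀ e ∈ C,
      lower (P.revealed w S₀) e ≤ lower (P.revealed w S₀) f)
    (hU : ∀ C, IsCycleSet P.graph C → ∀ f ∈ C, f ∉ T → ∀ e ∈ C,
      upper (P.revealed w S₀) e ≤ upper (P.revealed w S₀) f)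
    (l : List P.Edge) (hl : l.Nodup) (hlT : ∀ f ∈ l, f ∉ T) (S : Finset P.Edge)
    (hS : ∀ f ∈ l, ∀ e ∈ closedCycle P.graph T f, e ∈ S ↔ e ∈ S₀) :
    (R.treatCycles b T l (P.known w S)).result w =
        P.known w (S ∪ (R.treatCycles b T l (P.known w S)).queries w) ∧
      (∀ f ∈ l, ∃ h, AlwaysMaximal
        (P.revealed w (S ∪ (R.treatCycles b T l (P.known w S)).queries w))
        (closedCycle P.graph T f) h) ∧
      ∀ Q, P.Feasible w Q → P.cost ((R.treatCycles b T l (P.known w S)).queries w) ≤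
        (l.map fun f => P.treatBound b f ((P.known w S₀).X T f) Q).sum := by
  induction l generalizing S with
  | nil => simp [treatCycles, Program.result, Program.queries, cost]
  | cons f l ih =>
    have hf : f ∉ T := hlT f List.mem_cons_self
    obtain ⟨C, hC, hfC⟩ := ((hG.isSpanningTree_iff T).1 hT).2 f hf
    have hcl := hG.closedCycle_eq hT hC hfC hf
    have hSC : ∀ e ∈ C, e ∈ S ↔ e ∈ S₀ := by
      have := hS f List.mem_cons_self
      rwa [hcl] at this
    have hL' : ∀ e ∈ C, lower (P.revealed w S) e ≤ lower (P.revealed w S) f := fun e he => by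
      rw [lower_congr (hSC e he), lower_congr (hSC f hfC)]
      exact hL C hC f hfC hf e he
    have hU' : ∀ e ∈ C, upper (P.revealed w S) e ≤ upper (P.revealed w S) f := fun e he => by
      rw [upper_congr (hSC e he), upper_congr (hSC f hfC)]
      exact hU C hC f hfC hf e he
    have hXS : (P.known w S).X T f = (P.known w S₀).X T f :=
      X_congr T f (by rwa [hcl]) (by rwa [hcl])
    obtain ⟨h1, ⟨m, hm⟩, h3, h4⟩ := R.treatCycle_spec hG hw b hT hC hfC hf hL' hU'
    set W := (R.treatCycle b T (P.known w S) f).queries w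
    -- The queries `W` lie on the cycle of `f`, which is edge-disjoint from the later cycles; their
    -- limits and neighbors are still those for `S₀`.
    have hnext : ∀ f' ∈ l, ∀ e ∈ closedCycle P.graph T f', e ∈ S ∪ W ↔ e ∈ S₀ := by
      intro f' hf' e he
      rw [Finset.mem_union, ← hS f' (List.mem_cons_of_mem f hf') e he, or_iff_left]
      intro heW
      obtain ⟨C', hC', hfC'⟩ := ((hG.isSpanningTree_iff T).1 hT).2 f'
        (hlT f' (List.mem_cons_of_mem f hf'))
      rw [hG.closedCycle_eq hT hC' hfC' (hlT f' (List.mem_cons_of_mem f hf'))] at he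
      obtain rfl := hG.eq_of_mem hC hC' (h3 e heW) he
      have := hG.eq_of_notMem hT hC hfC hf hfC' (hlT f' (List.mem_cons_of_mem f hf'))
      exact (List.nodup_cons.1 hl).1 (this ▸ hf')
    obtain ⟨i1, i2, i3⟩ := ih (List.nodup_cons.1 hl).2
      (fun f' hf' => hlT f' (List.mem_cons_of_mem f hf')) (S ∪ W) hnext
    simp only [treatCycles, Program.result_bind, Program.queries_bind, h1]
    rw [← Finset.union_assoc]
    refine ⟨i1, fun f' hf' => ?_, fun Q hQ => ?_⟩
    · rcases List.mem_cons.1 hf' with rfl | hf'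
      · rw [hcl]
        exact ⟨m, hw.alwaysMaximal_mono Finset.subset_union_left hm⟩
      · exact i2 f' hf'
    · rw [List.map_cons, List.sum_cons, ← hXS]
      exact (cost_union_le _ _).trans (add_le_add (h4 Q hQ) (i3 Q hQ))

theorem preprocess_spec (hG : IsCactus P.graph) (hw : P.Realizes w) :
    R.preprocess.result w = P.known w (R.preprocess.queries w) ∧
      R.lowerTree (R.preprocess.result w) = R.upperTree (R.preprocess.result w) ∧
      ∀ Q, P.Feasible w Q → R.preprocess.queries w ⊆ Q := by
  have h := R.preprocessAux_spec hG hw (Nat.card P.Edge) ∅ (Nat.le_add_right _ _)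
  rw [known_empty, Finset.empty_union] at h
  exact ⟨h.1, h.2.1, fun Q hQ => h.2.2 Q (Finset.empty_subset Q) hQ⟩

theorem queries_randomC (hG : IsCactus P.graph) (hw : P.Realizes w) (b : ℝ) :
    (R.randomC b).queries w = R.preprocess.queries w ∪
      (R.treatCycles b (R.lowerTree (R.preprocess.result w)) (R.index (R.preprocess.result w))
        (P.known w (R.preprocess.queries w))).queries w := by
  rw [randomC, Program.queries_bind, (R.preprocess_spec hG hw).1]

theorem randomC_spec (hG : IsCactus P.graph) (hw : P.Realizes w) (b : ℝ) :
    P.Feasible w ((R.randomC b).queries w) ∧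
      ∀ Q, P.Feasible w Q → P.cost ((R.randomC b).queries w) ≤ P.cost (R.preprocess.queries w) +
        ((R.index (R.preprocess.result w)).map fun f => P.treatBound b f
          ((R.preprocess.result w).X (R.lowerTree (R.preprocess.result w)) f) Q).sum := by
  obtain ⟨h1, h2, -⟩ := R.preprocess_spec hG hw
  rw [R.queries_randomC hG hw b]
  generalize R.preprocess.result w = K at h1 h2 ⊢
  generalize R.preprocess.queries w = S₀ at h1 ⊢
  subst h1
  have hT := R.isSpanningTree_lowerTree hG (P.known w S₀)
  obtain ⟨-, h5, h6⟩ := R.treatCycles_spec hG hw b hT S₀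
    (fun C hC f hfC hf e he => R.lower_le hG (P.known w S₀) hC hfC hf he)
    (fun C hC f hfC hf e he => R.upper_le hG (P.known w S₀) hC hfC (by rwa [← h2]) he)
    (R.index (P.known w S₀)) (R.index_nodup _) (fun f hf => (R.mem_index _ f).1 hf) S₀
    (fun _ _ _ _ => Iff.rfl)
  refine ⟨(feasible_iff hG hw).2 fun C hC => ?_, fun Q hQ => ?_⟩
  · obtain ⟨f, hfC, hf, -⟩ := ((hG.isSpanningTree_iff _).1 hT).1 C hC
    have h := h5 f ((R.mem_index _ f).2 hf)
    rwa [hG.closedCycle_eq hT hC hfC hf] at h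
  · exact (cost_union_le _ _).trans (add_le_add_right (h6 Q hQ) _)

end ChoiceRule

end UncertaintyGraph

/-! ### The random threshold and the expected cost. -/

instance isProbabilityMeasure_uniform01 : IsProbabilityMeasure uniform01 :=
  ⟨by simp [uniform01]⟩

theorem integrable_ite_le (p a c : ℝ) :
    Integrable (fun b => if b ≤ p then a else c) uniform01 :=
  Integrable.of_bound (Measurable.ite measurableSet_Iic measurable_const
    measurable_const).aestronglyMeasurable (max |a| |c|) (Eventually.of_forall fun b => by
      simp only [Real.norm_eq_abs]
      split_ifs
      · exact le_max_left _ _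
      · exact le_max_right _ _)

theorem integral_ite_le {p : ℝ} (h0 : 0 ≤ p) (h1 : p ≤ 1) (a c : ℝ) :
    ∫ b, (if b ≤ p then a else c) ∂uniform01 = p * a + (1 - p) * c := by
  have hp : uniform01.real (Set.Iic p) = p := by
    have h : Set.Iic p ∩ Set.Icc 0 1 = Set.Icc 0 p := by
      ext x
      simp only [Set.mem_inter_iff, Set.mem_Iic, Set.mem_Icc]
      exact ⟨fun h => ⟨h.2.1, h.1⟩, fun h => ⟨h.2, h.1, h.2.trans h1⟩⟩
    rw [measureReal_def, uniform01, Measure.restrict_apply measurableSet_Iic, h, Real.volume_Icc,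
      sub_zero, ENNReal.toReal_ofReal h0]
  have hf : (fun b : ℝ => if b ≤ p then a else c) =
      fun b => (Set.Iic p).indicator (fun _ => a - c) b + c := by
    funext b
    by_cases h : b ≤ p <;> simp [h]
  rw [hf, integral_add ((integrable_const _).indicator measurableSet_Iic) (integrable_const _),
    integral_indicator_const _ measurableSet_Iic, hp, integral_const]
  simp
  ring

theorem cycleRatio_le (x y : ℝ) : cycleRatio x y ≤ 3 / 2 := by
  have h : x * y / (x ^ 2 + y ^ 2) ≤ 1 / 2 := by
    apply div_le_of_le_mul₀ (by positivity) (by norm_num)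
    nlinarith [sq_nonneg (x - y)]
  rw [cycleRatio]
  linarith

theorem one_le_cycleRatio {x y : ℝ} (hx : 0 ≤ x) (hy : 0 ≤ y) : 1 ≤ cycleRatio x y := by
  rw [cycleRatio]
  have : 0 ≤ x * y / (x ^ 2 + y ^ 2) := by positivity
  linarith

namespace UncertaintyGraph

variable {V : Type u} {P : UncertaintyGraph V} {w : P.Edge → ℝ}

theorem threshold_nonneg (f : P.Edge) (X : Finset P.Edge) : 0 ≤ P.threshold f X := by
  rw [threshold]
  positivity

theorem threshold_le_one (f : P.Edge) (X : Finset P.Edge) : P.threshold f X ≤ 1 := by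
  have := P.queryCost_pos f
  rw [threshold]
  apply div_le_one_of_le₀ <;> nlinarith [sq_nonneg (P.cost X)]

theorem integrable_treatBound (f : P.Edge) (X Q : Finset P.Edge) :
    Integrable (fun b => P.treatBound b f X Q) uniform01 := by
  unfold treatBound
  by_cases h : X = ∅
  · simp [h]
  · simp only [h, if_false]
    exact integrable_ite_le _ _ _

/-- The expected cost on the cycle closed by `f`. -/
theorem integral_treatBound_le {f : P.Edge} {X Q : Finset P.Edge} (hf : f ∉ X)
    (hQ : f ∉ Q → X ⊆ Q) :
    ∫ b, P.treatBound b f X Q ∂uniform01 ≤ cycleRatio (P.cost X) (P.queryCost f) *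
      P.cost (Q ∩ if X = ∅ then ∅ else insert f X) := by
  unfold treatBound
  by_cases h : X = ∅
  · simp [h, cost]
  · simp only [h, if_false]
    rw [integral_ite_le (threshold_nonneg f X) (threshold_le_one f X)]
    have hqf := P.queryCost_pos f
    have hqX := P.cost_nonneg X
    have hD : 0 < P.cost X ^ 2 + P.queryCost f ^ 2 := by positivity
    have hD' : P.queryCost f ^ 2 + P.cost X ^ 2 = P.cost X ^ 2 + P.queryCost f ^ 2 := add_comm _ _
    rw [threshold, hD', cycleRatio]
    by_cases hfQ : f ∈ Q
    · have hcost : P.cost (Q ∩ insert f X) = P.queryCost f + P.cost (X ∩ Q) := by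
        have h1 : Q ∩ insert f X = insert f (X ∩ Q) := by
          ext e
          simp only [Finset.mem_inter, Finset.mem_insert]
          constructor
          · rintro ⟨h1, h2 | h2⟩
            · exact Or.inl h2
            · exact Or.inr ⟨h2, h1⟩
          · rintro (rfl | h2)
            · exact ⟨hfQ, Or.inl rfl⟩
            · exact ⟨h2.2, Or.inr h2.1⟩
        rw [h1, cost, Finset.sum_insert (fun h2 => hf (Finset.mem_inter.1 h2).1)]
        rfl
      simp only [hfQ, if_true]
      rw [hcost]
      -- Equality holds for `c = 0`, that is when `Q` contains no neighbor of `f`; in general the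
      -- slack is `c` times a nonnegative factor.
      have hc := P.cost_nonneg (X ∩ Q)
      generalize P.cost (X ∩ Q) = c at hc ⊢
      generalize P.cost X = x at hqX hD ⊢
      generalize P.queryCost f = y at hqf hD ⊢
      have key : (1 + x * y / (x ^ 2 + y ^ 2)) * (y + c) - (y ^ 2 / (x ^ 2 + y ^ 2) * (x + y) +
          (1 - y ^ 2 / (x ^ 2 + y ^ 2)) * (y + c)) = c * (x * y + y ^ 2) / (x ^ 2 + y ^ 2) := by
        field_simp
        ring
      have : 0 ≤ c * (x * y + y ^ 2) / (x ^ 2 + y ^ 2) := by positivity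
      linarith
    · have hcost : Q ∩ insert f X = X := by
        ext e
        simp only [Finset.mem_inter, Finset.mem_insert]
        constructor
        · rintro ⟨h1, rfl | h2⟩
          · exact absurd h1 hfQ
          · exact h2
        · exact fun h1 => ⟨hQ hfQ h1, Or.inr h1⟩
      simp only [hfQ, if_false]
      rw [hcost]
      generalize P.cost X = x at hqX hD ⊢
      generalize P.queryCost f = y at hqf hD ⊢
      -- Here `Q` contains `X` but not `f`, and the threshold makes the bound exact.
      apply le_of_eq
      field_simp
      ring

section Measurability

variable {Ω : Type*} [MeasurableSpace Ω] [Finite V]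

theorem measurable_comp_queries {g : Ω → Finset P.Edge} (hg : ∀ Q, MeasurableSet {ω | g ω = Q})
    (h : Finset P.Edge → ℝ) : Measurable fun ω => h (g ω) := by
  -- The query sets form a finite type, so measurability of the fibres is enough and every function
  -- of the query set is measurable.
  let _ : MeasurableSpace (Finset P.Edge) := ⊤
  have hg' : Measurable g := measurable_to_countable' hg
  exact (measurable_from_top (f := h)).comp hg'

theorem integrable_cost {μ : Measure Ω} [IsProbabilityMeasure μ] {g : Ω → Finset P.Edge}
    (hg : ∀ Q, MeasurableSet {ω | g ω = Q}) : Integrable (fun ω => P.cost (g ω)) μ := by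
  have := Fintype.ofFinite P.Edge
  refine Integrable.of_bound (measurable_comp_queries hg P.cost).aestronglyMeasurable
    (P.cost Finset.univ) (Eventually.of_forall fun ω => ?_)
  rw [Real.norm_eq_abs, abs_of_nonneg (P.cost_nonneg _)]
  exact cost_mono (Finset.subset_univ _)

end Measurability

theorem opt_le {Q : Finset P.Edge} (hQ : P.Feasible w Q) : P.opt w ≤ P.cost Q :=
  csInf_le ⟨0, by rintro _ ⟨Q, -, rfl⟩; exact P.cost_nonneg Q⟩ ⟨Q, hQ, rfl⟩

/-- It suffices to compare with every feasible set. One must exist, because `sInf ∅ = 0` in `ℝ`. -/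
theorem le_mul_opt {r c : ℝ} (hr : 0 < r) (hne : ∃ Q, P.Feasible w Q)
    (h : ∀ Q, P.Feasible w Q → c ≤ r * P.cost Q) : c ≤ r * P.opt w := by
  rw [mul_comm, ← div_le_iff₀ hr]
  obtain ⟨Q, hQ⟩ := hne
  refine le_csInf ⟨_, Q, hQ, rfl⟩ ?_
  rintro _ ⟨Q, hQ, rfl⟩
  rw [div_le_iff₀ hr, mul_comm]
  exact h Q hQ

namespace ChoiceRule

variable [Finite V] (R : P.ChoiceRule)

/-- The run depends on `b` only through comparisons with thresholds, and each cycle leads to one of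
two states. Quantifying over all `s` lets the queries made so far be absorbed into a preimage of
`s`. -/
theorem measurableSet_treatCycles (w : P.Edge → ℝ) (T : Finset P.Edge) (l : List P.Edge)
    (K : P.Knowledge) (s : Set (Finset P.Edge)) :
    MeasurableSet {b | (R.treatCycles b T l K).queries w ∈ s} := by
  induction l generalizing K s with
  | nil =>
    simp only [treatCycles]
    exact MeasurableSet.const _
  | cons f l ih =>
    simp only [treatCycles, Program.queries_bind]
    by_cases hX : K.X T f = ∅
    · simp only [treatCycle, hX, if_true]
      exact ih _ ((fun Q => _ ∪ Q) ⁻¹' s)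
    · set p := P.queryCost f ^ 2 / (P.queryCost f ^ 2 + P.cost (K.X T f) ^ 2)
      set A := (queryAll (K.X T f).toList K).bind (R.finish (closedCycle P.graph T f))
      set B : Program P.Edge P.Knowledge :=
        .query f (fun x => R.finish (closedCycle P.graph T f) (K.reveal f x))
      have hset : {b : ℝ | (R.treatCycle b T K f).queries w ∪
          (R.treatCycles b T l ((R.treatCycle b T K f).result w)).queries w ∈ s} =
          (Set.Iic p ∩ {b | A.queries w ∪ (R.treatCycles b T l (A.result w)).queries w ∈ s}) ∪
          ((Set.Iic p)ᶜ ∩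
            {b | B.queries w ∪ (R.treatCycles b T l (B.result w)).queries w ∈ s}) := by
        ext b
        by_cases hb : b ≤ p
        · have h : R.treatCycle b T K f = A := by
            rw [treatCycle, if_neg hX, if_pos hb]
          simp [h, hb]
        · have h : R.treatCycle b T K f = B := by
            rw [treatCycle, if_neg hX, if_neg hb]
          simp [h, not_le.1 hb]
      rw [hset]
      exact (measurableSet_Iic.inter (ih _ ((fun Q => _ ∪ Q) ⁻¹' s))).union
        (measurableSet_Iic.compl.inter (ih _ ((fun Q => _ ∪ Q) ⁻¹' s)))

theorem measurableSet_queries_randomC (w : P.Edge → ℝ) (Q : Finset P.Edge) :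
    MeasurableSet {b | (R.randomC b).queries w = Q} := by
  simp only [randomC, Program.queries_bind]
  exact R.measurableSet_treatCycles w _ _ _ ((fun Q' => _ ∪ Q') ⁻¹' {Q})

theorem isRandomizedAlgorithm (hG : IsCactus P.graph) :
    P.IsRandomizedAlgorithm uniform01 R.randomC :=
  ⟨inferInstance, fun w hw => ⟨R.measurableSet_queries_randomC w,
    Eventually.of_forall fun b => (R.randomC_spec hG hw b).1⟩⟩

/-- The expected cost of the algorithm, if all cycles have at most the ratio `r`. -/
theorem expectedCost_le (hG : IsCactus P.graph) (hw : P.Realizes w) {r : ℝ} (hr : 1 ≤ r)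
    (h : ∀ f ∉ R.lowerTree (R.preprocess.result w),
      cycleRatio (P.cost ((R.preprocess.result w).X (R.lowerTree (R.preprocess.result w)) f))
        (P.queryCost f) ≤ r) :
    P.expectedCost uniform01 R.randomC w ≤ r * P.opt w := by
  -- The run for `b = 0` serves only to show that some feasible set exists.
  refine le_mul_opt (by linarith) ⟨_, (R.randomC_spec hG hw 0).1⟩ fun Q hQ => ?_
  have hcost := fun b => (R.randomC_spec hG hw b).2 Q hQ
  obtain ⟨h1, h2, h3⟩ := R.preprocess_spec hG hw
  replace h3 := h3 Q hQ
  generalize R.preprocess.result w = K at h h1 h2 hcost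
  generalize R.preprocess.queries w = S at h1 h3 hcost
  subst h1
  have hT := R.isSpanningTree_lowerTree hG (P.known w S)
  have hL : ∀ C, IsCycleSet P.graph C → ∀ f ∈ C, f ∉ R.lowerTree (P.known w S) → ∀ e ∈ C,
      lower (P.revealed w S) e ≤ lower (P.revealed w S) f :=
    fun C hC f hfC hf e he => R.lower_le hG (P.known w S) hC hfC hf he
  have hU : ∀ C, IsCycleSet P.graph C → ∀ f ∈ C, f ∉ R.lowerTree (P.known w S) → ∀ e ∈ C,
      upper (P.revealed w S) e ≤ upper (P.revealed w S) f :=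
    fun C hC f hfC hf e he => R.upper_le hG (P.known w S) hC hfC (by rwa [← h2]) he
  have hind := R.mem_index (P.known w S)
  have hnodup := R.index_nodup (P.known w S)
  generalize R.lowerTree (P.known w S) = T at *
  generalize R.index (P.known w S) = l at *
  set X := fun f => (P.known w S).X T f
  -- `Y f` is the part of the cycle to which its cost is charged. Without neighbors nothing is
  -- charged: `f` may then lie in `S`, and `Y f` must avoid `S`.
  set Y : P.Edge → Finset P.Edge := fun f => if X f = ∅ then ∅ else insert f (X f) with hY
  have hXmem : ∀ C, IsCycleSet P.graph C → ∀ f ∈ C, f ∉ T → ∀ e, e ∈ X f ↔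
      e ∈ neighbors (P.revealed w S) C f := fun C hC f hfC hf e => mem_X hG hT hC hfC hf
  have hYmem : ∀ C, IsCycleSet P.graph C → ∀ f ∈ C, f ∉ T → ∀ e ∈ Y f, e ∈ C ∧ e ∉ S := by
    intro C hC f hfC hf e he
    simp only [hY] at he
    split_ifs at he with hXe
    · exact absurd he (Finset.notMem_empty e)
    · obtain ⟨x, hx⟩ := Finset.nonempty_iff_ne_empty.2 hXe
      rcases Finset.mem_insert.1 he with rfl | he
      · exact ⟨hfC, (hw.notMem_of_neighbors (hL C hC e hfC hf) (hU C hC e hfC hf)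
          ((hXmem C hC e hfC hf x).1 hx)).2.1⟩
      · have he := (hXmem C hC f hfC hf e).1 he
        exact ⟨he.1, (hw.notMem_of_neighbors (hL C hC f hfC hf) (hU C hC f hfC hf) he).2.2⟩
  have hterm : ∀ f ∈ l, ∫ b, P.treatBound b f (X f) Q ∂uniform01 ≤ r * P.cost (Q ∩ Y f) := by
    intro f hfl
    have hf := (hind f).1 hfl
    obtain ⟨C, hC, hfC⟩ := ((hG.isSpanningTree_iff T).1 hT).2 f hf
    refine (integral_treatBound_le ?_ ?_).trans
      (mul_le_mul_of_nonneg_right (h f hf) (P.cost_nonneg _))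
    · intro hmem
      exact ((hXmem C hC f hfC hf f).1 hmem).2.1 rfl
    · intro hfQ e he
      obtain ⟨g, hg⟩ := (feasible_iff hG hw).1 hQ C hC
      exact hw.mem_or_mem h3 hfC (hL C hC f hfC hf) (hU C hC f hfC hf)
        ((hXmem C hC f hfC hf e).1 he) hg hfQ
  -- The sets `Y f` lie on different cycles and outside `S`, so the shares of `Q` are disjoint parts
  -- of `Q \ S`.
  have hsum : (l.map fun f => P.cost (Q ∩ Y f)).sum ≤ P.cost (Q \ S) := by
    rw [← List.sum_toFinset _ hnodup]
    simp only [cost]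
    rw [← Finset.sum_biUnion]
    · refine cost_mono fun e he => ?_
      obtain ⟨f, hf, he⟩ := Finset.mem_biUnion.1 he
      have hf := (hind f).1 (List.mem_toFinset.1 hf)
      obtain ⟨C, hC, hfC⟩ := ((hG.isSpanningTree_iff T).1 hT).2 f hf
      rw [Finset.mem_inter] at he
      exact Finset.mem_sdiff.2 ⟨he.1, (hYmem C hC f hfC hf e he.2).2⟩
    · intro f hf f' hf' hne
      refine Finset.disjoint_left.2 fun e he he' => hne ?_
      rw [Finset.mem_coe, List.mem_toFinset, hind] at hf hf'
      rw [Finset.mem_inter] at he he'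
      obtain ⟨C, hC, hfC⟩ := ((hG.isSpanningTree_iff T).1 hT).2 f hf
      obtain ⟨C', hC', hfC'⟩ := ((hG.isSpanningTree_iff T).1 hT).2 f' hf'
      obtain rfl := hG.eq_of_mem hC hC' (hYmem C hC f hfC hf e he.2).1
        (hYmem C' hC' f' hfC' hf' e he'.2).1
      exact hG.eq_of_notMem hT hC hfC hf hfC' hf'
  have hlist : ∀ l : List P.Edge,
      Integrable (fun b => (l.map fun f => P.treatBound b f (X f) Q).sum) uniform01 ∧
      ∫ b, (l.map fun f => P.treatBound b f (X f) Q).sum ∂uniform01 =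
        (l.map fun f => ∫ b, P.treatBound b f (X f) Q ∂uniform01).sum := by
    intro l
    induction l with
    | nil => simp
    | cons f l ih =>
      simp only [List.map_cons, List.sum_cons]
      refine ⟨(integrable_treatBound f _ Q).add ih.1, ?_⟩
      rw [integral_add (integrable_treatBound f _ Q) ih.1, ih.2]
  calc P.expectedCost uniform01 R.randomC w
      ≤ ∫ b, (P.cost S + (l.map fun f => P.treatBound b f (X f) Q).sum) ∂uniform01 :=
        integral_mono (integrable_cost (R.measurableSet_queries_randomC w))
          ((integrable_const _).add (hlist l).1) hcost
    _ = P.cost S + (l.map fun f => ∫ b, P.treatBound b f (X f) Q ∂uniform01).sum := by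
        rw [integral_add (integrable_const _) (hlist l).1, (hlist l).2]
        simp
    _ ≤ P.cost S + (l.map fun f => r * P.cost (Q ∩ Y f)).sum :=
        add_le_add_right (List.sum_le_sum hterm) _
    _ = P.cost S + r * (l.map fun f => P.cost (Q ∩ Y f)).sum := by
        rw [List.sum_map_mul_left]
    _ ≤ r * P.cost S + r * P.cost (Q \ S) := by
        have h4 := P.cost_nonneg S
        have h5 : P.cost S ≤ r * P.cost S := by nlinarith
        have h6 := mul_le_mul_of_nonneg_left hsum (by linarith : (0 : ℝ) ≤ r)
        linarith
    _ = r * P.cost Q := by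
        have h4 := Finset.sum_sdiff (f := P.queryCost) h3
        simp only [cost]
        rw [← mul_add, add_comm, h4]

end ChoiceRule

/-- The choices described by the algorithm exist on every cactus. -/
theorem nonempty_choiceRule [Finite V] (hG : IsCactus P.graph) : Nonempty P.ChoiceRule := by
  have := Fintype.ofFinite P.Edge
  have htrees : ∀ K : P.Knowledge, ∃ p : Finset P.Edge × Finset P.Edge,
      (K.IsLowerTree p.1 ∧ K.IsUpperTree p.2) ∧ ∀ q : Finset P.Edge × Finset P.Edge,
        K.IsLowerTree q.1 ∧ K.IsUpperTree q.2 → (p.1 \ p.2).card ≤ (q.1 \ q.2).card := by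
    intro K
    obtain ⟨T, hT⟩ := hG.exists_isLimitMST (lower K.sets)
    obtain ⟨T', hT'⟩ := hG.exists_isLimitMST (upper K.sets)
    exact Set.exists_min_image {p : Finset P.Edge × Finset P.Edge |
      K.IsLowerTree p.1 ∧ K.IsUpperTree p.2} (fun p => (p.1 \ p.2).card) (Set.toFinite _)
      ⟨(T, T'), hT, hT'⟩
  choose t ht htmin using htrees
  have hpick : ∀ (K : P.Knowledge) (C : Set P.Edge), ∃ o : Option P.Edge,
      (∃ e ∈ C, e ∉ K.queried) → ∃ g, o = some g ∧ g ∈ C ∧ g ∉ K.queried ∧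
        ∀ e ∈ C, e ∉ K.queried → upper K.sets e ≤ upper K.sets g := by
    intro K C
    by_cases h : ∃ e ∈ C, e ∉ K.queried
    · obtain ⟨g, ⟨hgC, hgK⟩, hg⟩ := Set.exists_max_image {e | e ∈ C ∧ e ∉ K.queried}
        (upper K.sets) (Set.toFinite _) h
      exact ⟨some g, fun _ => ⟨g, rfl, hgC, hgK, fun e he heK => hg e ⟨he, heK⟩⟩⟩
    · exact ⟨none, fun h' => absurd h' h⟩
  choose pick pick_spec using hpick
  exact ⟨{
    lowerTree := fun K => (t K).1
    upperTree := fun K => (t K).2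
    lowerTree_spec := fun K => (ht K).1
    upperTree_spec := fun K => (ht K).2
    agree := fun K T T' hT hT' => htmin K (T, T') ⟨hT, hT'⟩
    index := fun K => (t K).1ᶜ.toList
    index_nodup := fun K => Finset.nodup_toList _
    mem_index := fun K e => by simp
    pick := pick
    pick_spec := pick_spec }⟩

end UncertaintyGraph

/-! ### The triangle and the lower bound for randomized algorithms. -/

theorem isGLB_coe_Ioo {a b : ℝ} (h : a < b) :
    IsGLB ((fun x : ℝ => (x : EReal)) '' Set.Ioo a b) a := by
  constructor
  · rintro _ ⟨x, hx, rfl⟩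
    exact EReal.coe_le_coe_iff.2 hx.1.le
  · intro m hm
    by_contra! hlt
    obtain ⟨r, har, hrm⟩ := EReal.lt_iff_exists_real_btwn.1 hlt
    obtain ⟨y, hay, hy⟩ := exists_between (lt_min (EReal.coe_lt_coe_iff.1 har) h)
    have h1 : m ≤ (y : EReal) := hm ⟨y, ⟨hay, hy.trans_le (min_le_right _ _)⟩, rfl⟩
    have h2 : (y : EReal) < r := EReal.coe_lt_coe_iff.2 (hy.trans_le (min_le_left _ _))
    exact lt_irrefl _ (h1.trans_lt (h2.trans hrm))

theorem isLUB_coe_Ioo {a b : ℝ} (h : a < b) :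
    IsLUB ((fun x : ℝ => (x : EReal)) '' Set.Ioo a b) b := by
  constructor
  · rintro _ ⟨x, hx, rfl⟩
    exact EReal.coe_le_coe_iff.2 hx.2.le
  · intro m hm
    by_contra! hlt
    obtain ⟨r, hmr, hrb⟩ := EReal.lt_iff_exists_real_btwn.1 hlt
    obtain ⟨y, hy, hyb⟩ := exists_between (max_lt (EReal.coe_lt_coe_iff.1 hrb) h)
    have h1 : (y : EReal) ≤ m := hm ⟨y, ⟨(le_max_right _ _).trans_lt hy, hyb⟩, rfl⟩
    have h2 : (r : EReal) < y := EReal.coe_lt_coe_iff.2 ((le_max_left _ _).trans_lt hy)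
    exact lt_irrefl _ (h1.trans_lt (hmr.trans h2))

namespace UncertaintyGraph

/-- `P` is a triangle with the edges `f`, `e` and `h`, which have the uncertainty sets `(1, 3)`,
`(0, 2)` and `{0}` and the query costs `a`, `c` and `1`. -/
structure IsTriangle {V : Type u} (P : UncertaintyGraph V) (f e h : P.Edge) (a c : ℝ) : Prop where
  isSingleCycle : IsSingleCycle P.graph
  cases : ∀ g, g = f ∨ g = e ∨ g = h
  e_ne_f : e ≠ f
  h_ne_f : h ≠ f
  h_ne_e : h ≠ e
  sets_f : P.sets f = Set.Ioo 1 3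
  sets_e : P.sets e = Set.Ioo 0 2
  sets_h : P.sets h = {0}
  queryCost_f : P.queryCost f = a
  queryCost_e : P.queryCost e = c
  queryCost_h : P.queryCost h = 1

theorem isSingleCycle_top_fin_three : IsSingleCycle (⊤ : SimpleGraph (Fin 3)) := by
  have h01 : (⊤ : SimpleGraph (Fin 3)).Adj 0 1 := by simp
  have h12 : (⊤ : SimpleGraph (Fin 3)).Adj 1 2 := by simp
  have h20 : (⊤ : SimpleGraph (Fin 3)).Adj 2 0 := by simp
  refine ⟨0, .cons h01 (.cons h12 (.cons h20 .nil)), ?_, ?_, ?_⟩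
  · rw [SimpleGraph.Walk.cons_isCycle_iff]
    simp
  · intro y
    fin_cases y <;> simp
  · rintro ⟨i, j⟩ h
    have h : i ≠ j := h
    revert h
    fin_cases i <;> fin_cases j <;> simp

theorem exists_isTriangle {a c : ℝ} (ha : 0 < a) (hc : 0 < c) :
    ∃ (P : UncertaintyGraph (Fin 3)) (f e h : P.Edge), P.IsTriangle f e h a c := by
  set G : SimpleGraph (Fin 3) := ⊤ with hG
  obtain ⟨f, e, h, hcases, hef, hhf, hhe⟩ : ∃ f e h : G.edgeSet,
      (∀ g, g = f ∨ g = e ∨ g = h) ∧ e ≠ f ∧ h ≠ f ∧ h ≠ e := by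
    refine ⟨⟨s(0, 1), by simp [hG]⟩, ⟨s(1, 2), by simp [hG]⟩, ⟨s(0, 2), by simp [hG]⟩, ?_,
      by simp, by simp, by simp⟩
    rintro ⟨⟨i, j⟩, h⟩
    have h : i ≠ j := h
    simp only [Subtype.mk.injEq]
    revert h
    fin_cases i <;> fin_cases j <;> simp
  set A : G.edgeSet → Set ℝ := fun g => if g = f then Set.Ioo 1 3 else
    if g = e then Set.Ioo 0 2 else {0} with hA
  set q : G.edgeSet → ℝ := fun g => if g = f then a else if g = e then c else 1 with hq
  have hAf : A f = Set.Ioo 1 3 := by simp [hA]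
  have hAe : A e = Set.Ioo 0 2 := by simp [hA, hef]
  have hAh : A h = {0} := by simp [hA, hhf, hhe]
  have hqf : q f = a := by simp [hq]
  have hqe : q e = c := by simp [hq, hef]
  have hqh : q h = 1 := by simp [hq, hhf, hhe]
  have hopen : ∀ (g : G.edgeSet) (s t : ℝ), s < t → A g = Set.Ioo s t → ∀ x ∈ A g,
      (x : EReal) ≠ lower A g ∧ (x : EReal) ≠ upper A g := by
    intro g s t hst hg x hx
    rw [hg] at hx
    rw [lower, upper, hg, (isGLB_coe_Ioo hst).sInf_eq, (isLUB_coe_Ioo hst).sSup_eq]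
    exact ⟨(EReal.coe_lt_coe_iff.2 hx.1).ne', (EReal.coe_lt_coe_iff.2 hx.2).ne⟩
  refine ⟨⟨G, isSingleCycle_top_fin_three.isCactus.1, A, ?_, ?_, q, ?_⟩, f, e, h,
    ⟨isSingleCycle_top_fin_three, hcases, hef, hhf, hhe, hAf, hAe, hAh, hqf, hqe, hqh⟩⟩
  · intro g
    rcases hcases g with rfl | rfl | rfl
    · rw [hAf]
      exact Set.nonempty_Ioo.2 (by norm_num)
    · rw [hAe]
      exact Set.nonempty_Ioo.2 (by norm_num)
    · rw [hAh]
      exact Set.singleton_nonempty _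
  · intro g
    rcases hcases g with rfl | rfl | rfl
    · exact Or.inr (hopen _ 1 3 (by norm_num) hAf)
    · exact Or.inr (hopen _ 0 2 (by norm_num) hAe)
    · exact Or.inl ⟨0, hAh⟩
  · intro g
    rcases hcases g with rfl | rfl | rfl
    · rwa [hqf]
    · rwa [hqe]
    · rw [hqh]
      exact one_pos

/-- If an edge is a feasible query set and belongs to all of them, its cost is optimal. -/
theorem opt_eq {V : Type u} {P : UncertaintyGraph V} {w : P.Edge → ℝ} {e : P.Edge}
    (h : P.Feasible w {e}) (h' : ∀ Q, P.Feasible w Q → e ∈ Q) : P.opt w = P.queryCost e := by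
  apply le_antisymm
  · simpa [cost] using opt_le h
  · have h1 := le_mul_opt (r := 1) (c := P.queryCost e) one_pos ⟨_, h⟩ fun Q hQ => by
      have := cost_mono (Finset.singleton_subset_iff.2 (h' Q hQ))
      simpa [cost] using this
    simpa using h1

/-- No program finds cheapest query sets for both of two weight functions with different
optimal queries, since the first query does not depend on the weights. -/
theorem three_le_cost {V : Type u} {P : UncertaintyGraph V} {α : Type v} {w₁ w₂ : P.Edge → ℝ} (p : Program P.Edge α) {e f : P.Edge}
    (hcost : ∀ g, P.queryCost g = 1) (hef : e ≠ f) (he : e ∈ p.queries w₁)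
    (hf : f ∈ p.queries w₂) : 3 ≤ P.cost (p.queries w₁) + P.cost (p.queries w₂) := by
  have hcard : ∀ Q : Finset P.Edge, P.cost Q = Q.card := fun Q => by simp [cost, hcost]
  rw [hcard, hcard]
  cases p with
  | done a => simp [Program.queries] at he
  | query g next =>
    have h1 : g ∈ (Program.query g next).queries w₁ := by simp [Program.queries]
    have h2 : g ∈ (Program.query g next).queries w₂ := by simp [Program.queries]
    generalize (Program.query g next).queries w₁ = Q₁ at *
    generalize (Program.query g next).queries w₂ = Q₂ at *
    have h3 : 1 ≤ Q₁.card := Finset.card_pos.2 ⟨g, h1⟩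
    have h4 : 1 ≤ Q₂.card := Finset.card_pos.2 ⟨g, h2⟩
    -- If the common first query `g` is `e`, the run for `w₂` contains `e` and `f`; otherwise the
    -- run for `w₁` contains `g` and `e`.
    by_cases hge : g = e
    · subst hge
      have h5 : 2 ≤ Q₂.card := Finset.one_lt_card.2 ⟨g, h2, f, hf, hef⟩
      exact_mod_cast Nat.add_le_add h3 h5
    · have h5 : 2 ≤ Q₁.card := Finset.one_lt_card.2 ⟨g, h1, e, he, hge⟩
      exact_mod_cast Nat.add_le_add h5 h4

namespace IsTriangle

variable {V : Type u} {P : UncertaintyGraph V} {f e h : P.Edge} {a c : ℝ} {w : P.Edge → ℝ}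
  {Q : Finset P.Edge}

theorem exists_realizes (hP : P.IsTriangle f e h a c) {x y : ℝ} (hx : x ∈ Set.Ioo (1 : ℝ) 3)
    (hy : y ∈ Set.Ioo (0 : ℝ) 2) : ∃ w, P.Realizes w ∧ w f = x ∧ w e = y := by
  refine ⟨fun g => if g = f then x else if g = e then y else 0, fun g => ?_, by simp,
    by simp [hP.e_ne_f]⟩
  rcases hP.cases g with rfl | rfl | rfl
  · simpa [hP.sets_f] using hx
  · simpa [hP.sets_e, hP.e_ne_f] using hy
  · simp [hP.sets_h, hP.h_ne_f, hP.h_ne_e]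

theorem lower_f (hP : P.IsTriangle f e h a c) (hf : f ∉ Q) :
    lower (P.revealed w Q) f = ((1 : ℝ) : EReal) := by
  rw [lower, revealed, if_neg hf, hP.sets_f]
  exact (isGLB_coe_Ioo (by norm_num)).sInf_eq

theorem upper_f (hP : P.IsTriangle f e h a c) (hf : f ∉ Q) :
    upper (P.revealed w Q) f = ((3 : ℝ) : EReal) := by
  rw [upper, revealed, if_neg hf, hP.sets_f]
  exact (isLUB_coe_Ioo (by norm_num)).sSup_eq

theorem lower_e (hP : P.IsTriangle f e h a c) (he : e ∉ Q) :
    lower (P.revealed w Q) e = ((0 : ℝ) : EReal) := by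
  rw [lower, revealed, if_neg he, hP.sets_e]
  exact (isGLB_coe_Ioo (by norm_num)).sInf_eq

theorem upper_e (hP : P.IsTriangle f e h a c) (he : e ∉ Q) :
    upper (P.revealed w Q) e = ((2 : ℝ) : EReal) := by
  rw [upper, revealed, if_neg he, hP.sets_e]
  exact (isLUB_coe_Ioo (by norm_num)).sSup_eq

theorem revealed_h (hP : P.IsTriangle f e h a c) (hw : P.Realizes w) :
    P.revealed w Q h = {0} := by
  have hwh : w h = 0 := by simpa [hP.sets_h] using hw h
  rw [revealed, hP.sets_h, hwh, ite_self]

theorem lower_h (hP : P.IsTriangle f e h a c) (hw : P.Realizes w) :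
    lower (P.revealed w Q) h = ((0 : ℝ) : EReal) := by
  simp [lower, hP.revealed_h hw]

theorem upper_h (hP : P.IsTriangle f e h a c) (hw : P.Realizes w) :
    upper (P.revealed w Q) h = ((0 : ℝ) : EReal) := by
  simp [upper, hP.revealed_h hw]

variable [Finite V]

theorem feasible_iff (hP : P.IsTriangle f e h a c) (hw : P.Realizes w) :
    P.Feasible w Q ↔ ∃ g, AlwaysMaximal (P.revealed w Q) Set.univ g := by
  rw [UncertaintyGraph.feasible_iff hP.isSingleCycle.isCactus hw]
  constructor
  · exact fun h => h _ hP.isSingleCycle.isCycleSet_univ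
  · intro h C hC
    rwa [hP.isSingleCycle.eq_univ hC]

theorem feasible_singleton_e (hP : P.IsTriangle f e h a c) (hw : P.Realizes w) (he : w e ≤ 1) :
    P.Feasible w {e} := by
  rw [hP.feasible_iff hw]
  refine ⟨f, Set.mem_univ _, fun g _ hne => ?_⟩
  rw [hP.lower_f (by simpa using hP.e_ne_f.symm)]
  rcases hP.cases g with rfl | rfl | rfl
  · exact absurd rfl hne
  · rw [upper_of_mem (Finset.mem_singleton_self _)]
    exact EReal.coe_le_coe_iff.2 he
  · rw [hP.upper_h hw]
    exact EReal.coe_le_coe_iff.2 zero_le_one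

theorem feasible_singleton_f (hP : P.IsTriangle f e h a c) (hw : P.Realizes w) (hf : 2 ≤ w f) :
    P.Feasible w {f} := by
  rw [hP.feasible_iff hw]
  refine ⟨f, Set.mem_univ _, fun g _ hne => ?_⟩
  rw [lower_of_mem (Finset.mem_singleton_self _)]
  rcases hP.cases g with rfl | rfl | rfl
  · exact absurd rfl hne
  · rw [hP.upper_e (by simpa using hP.e_ne_f)]
    exact EReal.coe_le_coe_iff.2 hf
  · rw [hP.upper_h hw]
    exact EReal.coe_le_coe_iff.2 (by linarith)

/-- The limits 0 and 2 of an unqueried `e` enclose `w f`, so neither `e` nor `f` is always maximal,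
and `h` is too light. -/
theorem e_mem (hP : P.IsTriangle f e h a c) (hw : P.Realizes w) (hf : w f < 2)
    (hQ : P.Feasible w Q) : e ∈ Q := by
  by_contra hX
  have hwf : w f ∈ Set.Ioo (1 : ℝ) 3 := hP.sets_f ▸ hw f
  obtain ⟨g, -, hg⟩ := (hP.feasible_iff hw).1 hQ
  rcases hP.cases g with rfl | rfl | rfl
  · have h1 := (hg e (Set.mem_univ _) hP.e_ne_f).trans (hw.lower_le Q _)
    rw [hP.upper_e hX, EReal.coe_le_coe_iff] at h1
    linarith
  · have h1 := (hw.le_upper Q f).trans (hg f (Set.mem_univ _) hP.e_ne_f.symm)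
    rw [hP.lower_e hX, EReal.coe_le_coe_iff] at h1
    linarith [hwf.1]
  · have h1 := hg e (Set.mem_univ _) hP.h_ne_e.symm
    rw [hP.upper_e hX, hP.lower_h hw, EReal.coe_le_coe_iff] at h1
    linarith

/-- The limits 1 and 3 of an unqueried `f` enclose `w e`. -/
theorem f_mem (hP : P.IsTriangle f e h a c) (hw : P.Realizes w) (he : 1 < w e)
    (hQ : P.Feasible w Q) : f ∈ Q := by
  by_contra hF
  have hwe : w e ∈ Set.Ioo (0 : ℝ) 2 := hP.sets_e ▸ hw e
  obtain ⟨g, -, hg⟩ := (hP.feasible_iff hw).1 hQ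
  rcases hP.cases g with rfl | rfl | rfl
  · have h1 := (hw.le_upper Q e).trans (hg e (Set.mem_univ _) hP.e_ne_f)
    rw [hP.lower_f hF, EReal.coe_le_coe_iff] at h1
    linarith
  · have h1 := (hg f (Set.mem_univ _) hP.e_ne_f.symm).trans (hw.lower_le Q _)
    rw [hP.upper_f hF, EReal.coe_le_coe_iff] at h1
    linarith [hwe.2]
  · have h1 := hg f (Set.mem_univ _) hP.h_ne_f.symm
    rw [hP.upper_f hF, hP.lower_h hw, EReal.coe_le_coe_iff] at h1
    linarith

theorem opt_eq_e (hP : P.IsTriangle f e h a c) (hw : P.Realizes w) (hf : w f < 2) (he : w e ≤ 1) :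
    P.opt w = c :=
  (opt_eq (hP.feasible_singleton_e hw he) fun _ hQ => hP.e_mem hw hf hQ).trans hP.queryCost_e

theorem opt_eq_f (hP : P.IsTriangle f e h a c) (hw : P.Realizes w) (hf : 2 ≤ w f) (he : 1 < w e) :
    P.opt w = a :=
  (opt_eq (hP.feasible_singleton_f hw hf) fun _ hQ => hP.f_mem hw he hQ).trans hP.queryCost_f

/-- Yao's principle with two inputs: almost every program in the support pays at least 3 on both
inputs together, so one of the two expected costs is at least `3 / 2`, while both optima are 1. -/
theorem exists_expectedCost_ge (hP : P.IsTriangle f e h 1 1) {Ω : Type v} [MeasurableSpace Ω]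
    (μ : Measure Ω) (A : Ω → Program P.Edge Unit) (hA : P.IsRandomizedAlgorithm μ A) :
    ∃ w, P.Realizes w ∧ 0 < P.opt w ∧ 3 / 2 * P.opt w ≤ P.expectedCost μ A w := by
  have hcost : ∀ g, P.queryCost g = 1 := by
    intro g
    rcases hP.cases g with rfl | rfl | rfl
    · exact hP.queryCost_f
    · exact hP.queryCost_e
    · exact hP.queryCost_h
  -- With `w f = 3/2 < 2` and `w e = 1/2 ≤ 1` the unique optimum is `{e}`; with `5/2` and `3/2` it
  -- is `{f}`.
  obtain ⟨w₁, hw₁, hf₁, he₁⟩ := hP.exists_realizes (x := 3 / 2) (y := 1 / 2)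
    ⟨by norm_num, by norm_num⟩ ⟨by norm_num, by norm_num⟩
  obtain ⟨w₂, hw₂, hf₂, he₂⟩ := hP.exists_realizes (x := 5 / 2) (y := 3 / 2)
    ⟨by norm_num, by norm_num⟩ ⟨by norm_num, by norm_num⟩
  have hopt₁ : P.opt w₁ = 1 := hP.opt_eq_e hw₁ (by rw [hf₁]; norm_num) (by rw [he₁]; norm_num)
  have hopt₂ : P.opt w₂ = 1 := hP.opt_eq_f hw₂ (by rw [hf₂]; norm_num) (by rw [he₂]; norm_num)
  obtain ⟨hμ, hA⟩ := hA
  obtain ⟨hm₁, hA₁⟩ := hA w₁ hw₁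
  obtain ⟨hm₂, hA₂⟩ := hA w₂ hw₂
  have hint₁ : Integrable (fun ω => P.cost ((A ω).queries w₁)) μ := integrable_cost hm₁
  have hint₂ : Integrable (fun ω => P.cost ((A ω).queries w₂)) μ := integrable_cost hm₂
  have hsum : 3 ≤ P.expectedCost μ A w₁ + P.expectedCost μ A w₂ := by
    rw [expectedCost, expectedCost, ← integral_add hint₁ hint₂]
    calc (3 : ℝ) = ∫ _, (3 : ℝ) ∂μ := by simp
      _ ≤ _ := by
        refine integral_mono_ae (integrable_const _) (hint₁.add hint₂) ?_
        filter_upwards [hA₁, hA₂] with ω h1 h2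
        exact three_le_cost (A ω) hcost hP.e_ne_f
          (hP.e_mem hw₁ (by rw [hf₁]; norm_num) h1) (hP.f_mem hw₂ (by rw [he₂]; norm_num) h2)
  by_cases h : 3 / 2 ≤ P.expectedCost μ A w₁
  · exact ⟨w₁, hw₁, by rw [hopt₁]; norm_num, by rw [hopt₁]; linarith⟩
  · exact ⟨w₂, hw₂, by rw [hopt₂]; norm_num, by rw [hopt₂]; linarith⟩

end IsTriangle

end UncertaintyGraph

/-- On a single cycle, exactly one edge is missing in a spanning tree. -/
theorem IsSingleCycle.exists_mem_iff {V : Type u} [Finite V] {G : SimpleGraph V}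
    (hG : IsSingleCycle G) {T : Finset G.edgeSet} (hT : IsSpanningTree G T) :
    ∃ f, ∀ e, e ∈ T ↔ e ≠ f := by
  obtain ⟨f, -, hf, h⟩ := ((hG.isCactus.isSpanningTree_iff T).1 hT).1 _ hG.isCycleSet_univ
  exact ⟨f, fun e => ⟨fun he hef => hf (hef ▸ he), h e (Set.mem_univ e)⟩⟩

/-! ### The bound on single cycles and its sharpness on the triangle. -/

namespace UncertaintyGraph

theorem ChoiceRule.preprocess_eq_done {V : Type u} {P : UncertaintyGraph V} [Finite V]
    (R : P.ChoiceRule) (h : R.lowerTree Knowledge.initial = R.upperTree Knowledge.initial) :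
    R.preprocess = .done Knowledge.initial := by
  rw [preprocess]
  cases Nat.card P.Edge with
  | zero => rfl
  | succ n => rw [preprocessAux, if_pos h]

theorem ChoiceRule.expectedCost_le_of_isSingleCycle {V : Type u} {P : UncertaintyGraph V}
    [Finite V] (R : P.ChoiceRule) (hG : IsSingleCycle P.graph) {w : P.Edge → ℝ}
    (hw : P.Realizes w) {f : P.Edge}
    (hf : ∀ e, e ∈ R.lowerTree (R.preprocess.result w) ↔ e ≠ f) :
    P.expectedCost uniform01 R.randomC w ≤
      cycleRatio (P.cost ((R.preprocess.result w).X (R.lowerTree (R.preprocess.result w)) f))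
        (P.queryCost f) * P.opt w := by
  refine R.expectedCost_le hG.isCactus hw
    (one_le_cycleRatio (P.cost_nonneg _) (P.queryCost_pos f).le) fun f' hf' => ?_
  have hff : f' = f := by
    by_contra h
    exact hf' ((hf f').2 h)
  rw [hff]

namespace IsTriangle

variable {V : Type u} [Finite V] {P : UncertaintyGraph V} {f e h : P.Edge} {a c : ℝ}
  {w : P.Edge → ℝ}

/-- The edge `f` is the only edge outside of the limit trees. -/
theorem mem_iff (hP : P.IsTriangle f e h a c) (hw : P.Realizes w) (R : P.ChoiceRule) :
    (∀ g, g ∈ R.lowerTree (P.known w ∅) ↔ g ≠ f) ∧ ∀ g, g ∈ R.upperTree (P.known w ∅) ↔ g ≠ f := by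
  have hG := hP.isSingleCycle.isCactus
  have hC := hP.isSingleCycle.isCycleSet_univ
  constructor
  · obtain ⟨g, hg⟩ := hP.isSingleCycle.exists_mem_iff (R.isSpanningTree_lowerTree hG (P.known w ∅))
    have hle : lower (P.revealed w ∅) f ≤ lower (P.revealed w ∅) g :=
      R.lower_le hG (P.known w ∅) hC (Set.mem_univ g) (fun h => (hg g).1 h rfl) (Set.mem_univ f)
    rw [hP.lower_f (Finset.notMem_empty f)] at hle
    rcases hP.cases g with rfl | rfl | rfl
    · exact hg
    · rw [hP.lower_e (Finset.notMem_empty g), EReal.coe_le_coe_iff] at hle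
      norm_num at hle
    · rw [hP.lower_h hw, EReal.coe_le_coe_iff] at hle
      norm_num at hle
  · obtain ⟨g, hg⟩ := hP.isSingleCycle.exists_mem_iff (R.isSpanningTree_upperTree hG (P.known w ∅))
    have hle : upper (P.revealed w ∅) f ≤ upper (P.revealed w ∅) g :=
      R.upper_le hG (P.known w ∅) hC (Set.mem_univ g) (fun h => (hg g).1 h rfl) (Set.mem_univ f)
    rw [hP.upper_f (Finset.notMem_empty f)] at hle
    rcases hP.cases g with rfl | rfl | rfl
    · exact hg
    · rw [hP.upper_e (Finset.notMem_empty g), EReal.coe_le_coe_iff] at hle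
      norm_num at hle
    · rw [hP.upper_h hw, EReal.coe_le_coe_iff] at hle
      norm_num at hle

theorem preprocess_eq (hP : P.IsTriangle f e h a c) (hw : P.Realizes w) (R : P.ChoiceRule) :
    R.preprocess = .done (P.known w ∅) := by
  obtain ⟨h1, h2⟩ := hP.mem_iff hw R
  rw [known_empty] at h1 h2 ⊢
  refine R.preprocess_eq_done (Finset.ext fun g => ?_)
  rw [h1, h2]

theorem X_eq (hP : P.IsTriangle f e h a c) (hw : P.Realizes w) (R : P.ChoiceRule) :
    (P.known w ∅).X (R.lowerTree (P.known w ∅)) f = {e} := by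
  have hG := hP.isSingleCycle.isCactus
  ext g
  rw [mem_X hG (R.isSpanningTree_lowerTree hG _) hP.isSingleCycle.isCycleSet_univ (Set.mem_univ f)
    (fun hmem => ((hP.mem_iff hw R).1 f).1 hmem rfl), Finset.mem_singleton]
  have hlf : lower (P.known w ∅).sets f = ((1 : ℝ) : EReal) := hP.lower_f (w := w) (Finset.notMem_empty f)
  constructor
  · rintro ⟨-, hgf, hlt⟩
    rcases hP.cases g with rfl | rfl | rfl
    · exact absurd rfl hgf
    · rfl
    · have hu : upper (P.known w ∅).sets g = ((0 : ℝ) : EReal) := hP.upper_h (Q := ∅) hw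
      rw [hlf, hu, EReal.coe_lt_coe_iff] at hlt
      norm_num at hlt
  · rintro rfl
    refine ⟨Set.mem_univ g, hP.e_ne_f, ?_⟩
    have hu : upper (P.known w ∅).sets g = ((2 : ℝ) : EReal) := hP.upper_e (w := w) (Finset.notMem_empty g)
    rw [hlf, hu, EReal.coe_lt_coe_iff]
    norm_num

theorem f_mem_queries (hP : P.IsTriangle f e h a c) (hw : P.Realizes w) (R : P.ChoiceRule) {b : ℝ}
    (hb : ¬ b ≤ P.threshold f {e}) : f ∈ (R.randomC b).queries w := by
  have hindex : f ∈ R.index (P.known w ∅) := (R.mem_index _ f).2 fun hmem =>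
    ((hP.mem_iff hw R).1 f).1 hmem rfl
  have hall : ∀ g ∈ R.index (P.known w ∅), g = f := by
    intro g hg
    by_contra hne
    exact (R.mem_index _ g).1 hg (((hP.mem_iff hw R).1 g).2 hne)
  rw [threshold] at hb
  rw [ChoiceRule.randomC, hP.preprocess_eq hw R, Program.bind]
  cases hl : R.index (P.known w ∅) with
  | nil => simp [hl] at hindex
  | cons g l =>
    obtain rfl := hall g (by simp [hl])
    have hX := hP.X_eq hw R
    rw [ChoiceRule.treatCycles, Program.queries_bind, Finset.mem_union, ChoiceRule.treatCycle, hX,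
      if_neg (Finset.singleton_ne_empty e), if_neg hb]
    left
    simp [Program.queries]

/-- The ratio is attained on the triangle. -/
theorem expectedCost_eq (hP : P.IsTriangle f e h a c) (hw : P.Realizes w) (hf : w f < 2)
    (he : w e ≤ 1) (R : P.ChoiceRule) :
    P.expectedCost uniform01 R.randomC w = cycleRatio c a * P.opt w := by
  have hG := hP.isSingleCycle.isCactus
  have hpre : R.preprocess.result w = P.known w ∅ := by
    rw [hP.preprocess_eq hw R]
    rfl
  have hcost : P.cost {e} = c := by simp [cost, hP.queryCost_e]
  have ha : 0 < a := hP.queryCost_f ▸ P.queryCost_pos f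
  have hc : 0 < c := hP.queryCost_e ▸ P.queryCost_pos e
  apply le_antisymm
  · have h1 := R.expectedCost_le_of_isSingleCycle hP.isSingleCycle hw (f := f)
      (by rw [hpre]; exact (hP.mem_iff hw R).1)
    rwa [hpre, hP.X_eq hw R, hcost, hP.queryCost_f] at h1
  · rw [hP.opt_eq_e hw hf he]
    -- Feasibility forces the query of `e` for every `b`, and above the threshold `f` is queried
    -- too. The resulting expectation `c + (1-p)a`, with `1-p = c²/(a²+c²)`, is the ratio times `c`.
    have hmem : ∀ b, e ∈ (R.randomC b).queries w := fun b =>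
      hP.e_mem hw hf (R.randomC_spec hG hw b).1
    calc cycleRatio c a * c
        = ∫ b, (if b ≤ P.threshold f {e} then c else a + c) ∂uniform01 := by
          rw [integral_ite_le (threshold_nonneg _ _) (threshold_le_one _ _), threshold, hcost,
            hP.queryCost_f, cycleRatio]
          field_simp
          ring
      _ ≤ P.expectedCost uniform01 R.randomC w := by
          refine integral_mono (integrable_ite_le _ _ _)
            (integrable_cost (R.measurableSet_queries_randomC w)) fun b => ?_
          dsimp only
          split_ifs with hb
          · rw [← hcost]
            exact cost_mono (Finset.singleton_subset_iff.2 (hmem b))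
          · have h2 : P.cost {f, e} = a + c := by
              rw [cost, Finset.sum_pair hP.e_ne_f.symm, hP.queryCost_f, hP.queryCost_e]
            rw [← h2]
            refine cost_mono (Finset.insert_subset (hP.f_mem_queries hw R hb) ?_)
            exact Finset.singleton_subset_iff.2 (hmem b)

end IsTriangle

end UncertaintyGraph

end MSTU

theorem theorem1 :
    -- on every cactus, `Random_C` exists, is correct and is `3/2`-competitive
    (∀ {V : Type u} [Finite V] (P : MSTU.UncertaintyGraph V), MSTU.IsCactus P.graph →
      Nonempty P.ChoiceRule ∧
      ∀ R : P.ChoiceRule,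
        P.IsRandomizedAlgorithm MSTU.uniform01 R.randomC ∧
        ∀ w, P.Realizes w →
          R.lowerTree (R.preprocess.result w) = R.upperTree (R.preprocess.result w) ∧
          (∀ b, P.Feasible w ((R.randomC b).queries w)) ∧
          P.expectedCost MSTU.uniform01 R.randomC w ≤ 3 / 2 * P.opt w) ∧
    -- this is best possible: already on one triangle with unit query costs, no randomized
    -- algorithm does better
    (∃ P : MSTU.UncertaintyGraph (Fin 3), MSTU.IsCactus P.graph ∧ MSTU.IsSingleCycle P.graph ∧
      (∀ e, P.queryCost e = 1) ∧
      ∀ {Ω : Type v} [MeasurableSpace Ω] (μ : MeasureTheory.Measure Ω)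
        (A : Ω → MSTU.Program P.Edge Unit), P.IsRandomizedAlgorithm μ A →
        ∃ w, P.Realizes w ∧ 0 < P.opt w ∧ 3 / 2 * P.opt w ≤ P.expectedCost μ A w) ∧
    -- on a single cycle, with `f` the edge outside the common limit tree after the preprocessing
    (∀ {V : Type u} [Finite V] (P : MSTU.UncertaintyGraph V), MSTU.IsSingleCycle P.graph →
      Nonempty P.ChoiceRule ∧
      ∀ (R : P.ChoiceRule) (w : P.Edge → ℝ), P.Realizes w →
        R.lowerTree (R.preprocess.result w) = R.upperTree (R.preprocess.result w) ∧
        ∃ f : P.Edge, (∀ e, e ∈ R.lowerTree (R.preprocess.result w) ↔ e ≠ f) ∧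
          P.expectedCost MSTU.uniform01 R.randomC w ≤
            MSTU.cycleRatio
              (P.cost ((R.preprocess.result w).X (R.lowerTree (R.preprocess.result w)) f))
              (P.queryCost f) * P.opt w) ∧
    -- the ratio on cycles is attained, for all possible values of the two costs
    (∀ a c : ℝ, 0 < a → 0 < c →
      ∃ (P : MSTU.UncertaintyGraph (Fin 3)) (w : P.Edge → ℝ),
        MSTU.IsSingleCycle P.graph ∧ P.Realizes w ∧ 0 < P.opt w ∧
        ∀ R : P.ChoiceRule,
          ∃ f : P.Edge, (∀ e, e ∈ R.lowerTree (R.preprocess.result w) ↔ e ≠ f) ∧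
            P.queryCost f = a ∧
            P.cost ((R.preprocess.result w).X (R.lowerTree (R.preprocess.result w)) f) = c ∧
            P.expectedCost MSTU.uniform01 R.randomC w = MSTU.cycleRatio c a * P.opt w) := by
  refine ⟨fun P hG => ⟨MSTU.UncertaintyGraph.nonempty_choiceRule hG, fun R =>
    ⟨R.isRandomizedAlgorithm hG, fun w hw => ⟨(R.preprocess_spec hG hw).2.1,
      fun b => (R.randomC_spec hG hw b).1, ?_⟩⟩⟩, ?_, fun P hG => ⟨?_, fun R w hw => ?_⟩, ?_⟩
  · exact R.expectedCost_le hG hw (by norm_num) fun f _ => MSTU.cycleRatio_le _ _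
  · obtain ⟨P, f, e, h, hP⟩ := MSTU.UncertaintyGraph.exists_isTriangle one_pos one_pos
    refine ⟨P, hP.isSingleCycle.isCactus, hP.isSingleCycle, fun g => ?_, fun μ A hA =>
      hP.exists_expectedCost_ge μ A hA⟩
    rcases hP.cases g with rfl | rfl | rfl
    · exact hP.queryCost_f
    · exact hP.queryCost_e
    · exact hP.queryCost_h
  · exact MSTU.UncertaintyGraph.nonempty_choiceRule hG.isCactus
  · refine ⟨(R.preprocess_spec hG.isCactus hw).2.1, ?_⟩
    obtain ⟨f, hf⟩ := hG.exists_mem_iff (R.isSpanningTree_lowerTree hG.isCactus _)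
    exact ⟨f, hf, R.expectedCost_le_of_isSingleCycle hG hw hf⟩
  · intro a c ha hc
    obtain ⟨P, f, e, h, hP⟩ := MSTU.UncertaintyGraph.exists_isTriangle ha hc
    obtain ⟨w, hw, hf, he⟩ := hP.exists_realizes (x := 3 / 2) (y := 1 / 2)
      ⟨by norm_num, by norm_num⟩ ⟨by norm_num, by norm_num⟩
    have hf : w f < 2 := by rw [hf]; norm_num
    have he : w e ≤ 1 := by rw [he]; norm_num
    refine ⟨P, w, hP.isSingleCycle, hw, by rwa [hP.opt_eq_e hw hf he], fun R => ⟨f, ?_⟩⟩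
    have hpre : R.preprocess.result w = P.known w ∅ := by
      rw [hP.preprocess_eq hw R]
      rfl
    rw [hpre, hP.X_eq hw R]
    refine ⟨(hP.mem_iff hw R).1, hP.queryCost_f, ?_, hP.expectedCost_eq hw hf he R⟩
    simp [MSTU.UncertaintyGraph.cost, hP.queryCost_e]
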